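/- **Definitions.** All graphs are simple and undirected, have vertex set $\{0,\dots,n-1\}$, and are represented by adjacency lists (each list in arbitrary order). For $\alpha\in[0,1]$, an *$\alpha$-erased graph* is obtained from the adjacency lists of such a graph with $m$ edges by replacing at most an $\alpha$ fraction of the $2m$ entries by a symbol $\bot$; its average degree is $\overline d=2m/n$. A degree query to a vertex $v$ returns the length of the list of $v$; a uniformly random neighbor query to $v$ returns a fresh uniformly random entry (a vertex or $\bot$) of the list of $v$ ($\bot$ if the list is empty). Algorithms are programs of a randomized random-access machine with query access to the erased graph. One step is one of: storing a constant, an addition, truncated subtraction, multiplication or integer division, an indirect load or store, drawing a uniformly random element of $\{0,\dots,k-1\}$, a degree query, a uniformly random neighbor query, or a test of a memory cell against $0$ (in a conditional or a while loop). The output is a rational number, given by its numerator and denominator. **Theorem.** There are a program $P$ and absolute constants $C$ and $k$ such that the following holds for all $\alpha\in[0,1]$, all $\varepsilon\in(0,1/2)$, all $n$, and every $\alpha$-erased graph on $n$ vertices with average degree $\overline d\ge 1$. On the input $n$ and $\lceil 1/\varepsilon\rceil$, with query access to the graph, 1. in every run, $P$ halts, makes at most $$C\cdot\sqrt n\cdot\max\{1,\log\log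 n\}\cdot(1/\varepsilon)^k$$ queries (each a degree query or a uniformly random neighbor query), takes at most $C$ times as many steps as it makes queries (so its running time is the same as its query complexity up to a constant factor), and stores only numbers that are at most $C\,(n/\varepsilon)^k$ (that is, words of $O(\log (n/\varepsilon))$ bits); 2. with probability at least $2/3$, the output $\widetilde d$ of $P$ satisfies $$(1-\varepsilon)\,\overline d<\widetilde d<\bigl(1+2\min(\alpha,\tfrac12)+\varepsilon\bigr)\,\overline d .$$ -/

import Mathlib

noncomputable section

namespace ErasureResilient

/-! ### Partially erased graphs -/

/-- Adjacency lists on the vertex set `{0, …, n-1}` whose entries may be erased (`none`). -/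
abbrev ErasedLists (n : ℕ) : Type := Fin n → List (Option (Fin n))

/-- `L` is an adjacency-lists representation (without erasures, in any order)
of the simple undirected graph `H`. -/
def IsAdjLists {n : ℕ} (H : SimpleGraph (Fin n)) (L : Fin n → List (Fin n)) : Prop :=
  ∀ v, (L v).Nodup ∧ ∀ u, u ∈ L v ↔ H.Adj v u

/-- `L` represents a simple undirected graph and coincides with `A` on all nonerased entries. -/
def IsCompletion {n : ℕ} (A : ErasedLists n) (L : Fin n → List (Fin n)) : Prop :=
  (∃ H : SimpleGraph (Fin n), IsAdjLists H L) ∧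
    ∀ v, List.Forall₂ (fun a b => a = none ∨ a = some b) (A v) (L v)

/-- The number of all entries in the lists, that is, twice the number of edges. -/
def numEntries {n : ℕ} (A : ErasedLists n) : ℕ := ∑ v, (A v).length

/-- The number of erased entries. -/
def numErased {n : ℕ} (A : ErasedLists n) : ℕ := ∑ v, (A v).count none

/-- `A` arises from the adjacency lists of a simple undirected graph by erasing
at most an `α` fraction of all entries. -/
def IsErasedGraph {n : ℕ} (α : ℝ) (A : ErasedLists n) : Prop :=
  (∃ L, IsCompletion A L) ∧ (numErased A : ℝ) ≤ α * (numEntries A : ℝ)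

/-- The average degree `2m / n`. -/
def avgDegree {n : ℕ} (A : ErasedLists n) : ℝ := (numEntries A : ℝ) / (n : ℝ)

/-! ### Query oracles

Vertices are named by `0, …, n-1`, and the number `n` stands for the symbol `⊥`. -/

/-- The degree of the vertex named `v` (`0` if `v` names no vertex). -/
def degreeOf {n : ℕ} (A : ErasedLists n) (v : ℕ) : ℕ :=
  if h : v < n then (A ⟨v, h⟩).length else 0

/-- The `i`-th entry (counted from `0`) of the list of the vertex named `v`;
`⊥` if this entry is erased or if there is no such entry. -/
def entryOf {n : ℕ} (A : ErasedLists n) (v i : ℕ) : ℕ :=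
  if h : v < n then
    match (A ⟨v, h⟩)[i]? with
    | some (some u) => (u : ℕ)
    | _ => n
  else n

/-- The uniform distribution on `{0, …, k-1}` (and the constant `0` if `k = 0`). -/
def unif (k : ℕ) : PMF ℕ :=
  PMF.uniformOfFinset (Finset.range (max k 1)) ⟨0, by simp⟩

/-- The answer to a uniformly random neighbor query: a uniformly random entry of the list of `v`
(`⊥` if this list is empty). -/
def randomNeighbor {n : ℕ} (A : ErasedLists n) (v : ℕ) : PMF ℕ :=
  (unif (degreeOf A v)).map (entryOf A v)

/-! ### Randomized random-access machines with query access to a partially erased graph -/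

/-- The arithmetic operations of the machine. -/
inductive ArithOp : Type
  | add
  | sub
  | mul
  | div

/-- Addition, truncated subtraction, multiplication, integer division. -/
def ArithOp.eval : ArithOp → ℕ → ℕ → ℕ
  | .add, x, y => x + y
  | .sub, x, y => x - y
  | .mul, x, y => x * y
  | .div, x, y => x / y

/-- Programs. Here `M[a]` is the content of the memory cell `a`. -/
inductive Program : Type
  /-- `M[d] := c` -/
  | const (d c : ℕ)
  /-- `M[d] := M[a] ∘ M[b]` -/
  | arith (o : ArithOp) (d a b : ℕ)
  /-- `M[d] := M[M[a]]` -/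
  | load (d a : ℕ)
  /-- `M[M[d]] := M[a]` -/
  | store (d a : ℕ)
  /-- `M[d] :=` a fresh uniformly random element of `{0, …, M[a]-1}` -/
  | rand (d a : ℕ)
  /-- `M[d] :=` the answer to the degree query to the vertex `M[a]` -/
  | degree (d a : ℕ)
  /-- `M[d] :=` the answer to a uniformly random neighbor query to the vertex `M[a]` -/
  | neighbor (d a : ℕ)
  /-- first `p`, then `q` -/
  | seq (p q : Program)
  /-- if `M[a] ≠ 0` then `p` else `q` -/
  | ite (a : ℕ) (p q : Program)
  /-- while `M[a] ≠ 0` do `p` -/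
  | while (a : ℕ) (p : Program)

/-- The memory of the machine, with the number of steps and of queries made so far
and the largest number that has been stored so far. -/
structure State : Type where
  mem : ℕ → ℕ
  steps : ℕ
  queries : ℕ
  peak : ℕ

/-- Count one step. -/
def State.tick (s : State) : State := { s with steps := s.steps + 1 }

/-- Count one query. -/
def State.ask (s : State) : State := { s with queries := s.queries + 1 }

/-- Store the number `x` in the cell `d`. -/
def State.write (s : State) (d x : ℕ) : State :=
  { s with mem := Function.update s.mem d x, peak := max s.peak x }

/-- While `M[a] ≠ 0` do `body`; the outcome is `none` if the test is still to be made after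
`k` rounds. Every test is one step. -/
def iterWhile (a : ℕ) (body : State → PMF (Option State)) : ℕ → State → PMF (Option State)
  | 0, _ => PMF.pure none
  | k + 1, s =>
    if s.mem a = 0 then PMF.pure (some s.tick)
    else (body s.tick).bind fun
      | none => PMF.pure none
      | some s' => iterWhile a body k s'

/-- The distribution of the final state of a program started in a given state. The outcome is
`none` if some loop has not stopped within `fuel` tests. Every instruction (a query or a random
draw included) and every test is one step. -/
def Program.run {n : ℕ} (A : ErasedLists n) (fuel : ℕ) : Program → State → PMF (Option State)
  | .const d c, s => PMF.pure (some (s.tick.write d c))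
  | .arith o d a b, s => PMF.pure (some (s.tick.write d (o.eval (s.mem a) (s.mem b))))
  | .load d a, s => PMF.pure (some (s.tick.write d (s.mem (s.mem a))))
  | .store d a, s => PMF.pure (some (s.tick.write (s.mem d) (s.mem a)))
  | .rand d a, s => (unif (s.mem a)).map fun x => some (s.tick.write d x)
  | .degree d a, s => PMF.pure (some (s.tick.ask.write d (degreeOf A (s.mem a))))
  | .neighbor d a, s =>
    (randomNeighbor A (s.mem a)).map fun x => some (s.tick.ask.write d x)
  | .seq p q, s => (Program.run A fuel p s).bind fun
      | none => PMF.pure none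
      | some s' => Program.run A fuel q s'
  | .ite a p q, s =>
    if s.mem a = 0 then Program.run A fuel q s.tick else Program.run A fuel p s.tick
  | .while a p, s => iterWhile a (Program.run A fuel p) fuel s

/-- The start: the inputs `x` and `y` are in the cells `0` and `1`, all other cells hold `0`. -/
def State.init (x y : ℕ) : State where
  mem := fun a => if a = 0 then x else if a = 1 then y else 0
  steps := 0
  queries := 0
  peak := max x y

/-- The output: the rational number whose numerator and denominator are in the cells
`0` and `1`. -/
def State.output (s : State) : ℝ := (s.mem 0 : ℝ) / (s.mem 1 : ℝ)

end ErasureResilient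

end

/-!
The program is a sampling estimator in two phases. Let `D = 2m` be the number of entries and
`d = D / n ≥ 1` the average degree.

For a random vertex `v` and a random entry `u` of its list, `deg v` times the weight of the entry is
an estimate of the average degree. The weight of a vertex `u` is `2`, `1` or `0`, as
`deg u` is larger than, equal to or smaller than `deg v`, so that the two entries of an edge get the
total weight `2`. The weight of an erased entry is `2` if `v` is light, which means that `(deg v)²`
is at most a threshold of order `D / ε`, and `0` otherwise. The expectation of the estimate is the
total weight of all entries, divided by `n`:

* Every erased entry adds at most `2` to the weight of its edge, and no edge gets more than `4`,
  so the expectation is at most `(1 + 2 min(α, 1/2)) d` (`Completes.pairSum_pairWeight_le`).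
* An edge gets less than `2` only if both ends are heavy: otherwise an erased entry at a light end
  counts `2`, and an unerased entry at a light end leads to a heavy vertex and counts `2` as well.
  Since there are at most `D / √(D / ε)` heavy vertices, at most `O(ε D)` entries are lost
  (`Completes.le_pairSum_pairWeight`).
* A vertex has at most `√D` neighbors of degree at least its own, and light vertices have at most
  `O(√(D / ε))` entries, so the second moment is at most `O(√(D / ε)) d`
  (`Completes.pairSum_sq_le`).

As `√D / d = n / √D ≤ √n`, Chebyshev's inequality (`prob_sumLaw_deviation_le`) shows that
`O(√n ε⁻³)` samples suffice (`Completes.prob_not_goodNumerators_le`).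

The threshold requires `D` up to a constant factor, which the first phase provides: the average
degree of `O(√n)` random vertices is at least `d / 4` with high probability, because the vertices of
degree at most `2 √D` have `3/8` of all entries and the degrees capped in this way have a
small variance (`Completes.prob_degreeSum_lt_le`), and it is at most `12 d` by Markov's inequality.
No search for `d` is needed, so the number of queries is even `O(√n ε⁻³)`.

Runs of the program are related to these distributions by couplings (`Simulates`), with loop
invariants that also record the numbers of steps and queries and the largest stored number. The
numbers of rounds of all loops are functions of the input alone.
-/

open scoped ENNReal

noncomputable section

namespace ErasureResilient

/-! ### Expectations and probabilities of discrete distributions -/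

/-- The expectation of a function with values in `[0, ∞]`. Working in `ℝ≥0∞` makes every exchange
of sums unconditional. -/
def expect {β : Type*} (p : PMF β) (f : β → ℝ≥0∞) : ℝ≥0∞ := ∑' b, p b * f b

/-- The probability of a set, as the expectation of its indicator. -/
def prob {β : Type*} (p : PMF β) (s : Set β) : ℝ≥0∞ := expect p (s.indicator 1)

section Expect

variable {β γ : Type*}

theorem expect_pure (b : β) (f : β → ℝ≥0∞) : expect (PMF.pure b) f = f b := by
  rw [expect, tsum_eq_single b]
  · simp
  · intro b' hb'
    simp [hb']

theorem expect_bind (p : PMF β) (g : β → PMF γ) (f : γ → ℝ≥0∞) :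
    expect (p.bind g) f = expect p fun b => expect (g b) f := by
  simp only [expect, PMF.bind_apply, ← ENNReal.tsum_mul_right, ← ENNReal.tsum_mul_left]
  rw [ENNReal.tsum_comm]
  simp only [mul_assoc]

theorem expect_map (p : PMF β) (g : β → γ) (f : γ → ℝ≥0∞) :
    expect (p.map g) f = expect p fun b => f (g b) := by
  rw [← PMF.bind_pure_comp, expect_bind]
  simp [expect_pure]

theorem expect_add (p : PMF β) (f g : β → ℝ≥0∞) :
    expect p (fun b => f b + g b) = expect p f + expect p g := by
  simp only [expect, mul_add, ENNReal.tsum_add]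

theorem expect_const_mul (p : PMF β) (c : ℝ≥0∞) (f : β → ℝ≥0∞) :
    expect p (fun b => c * f b) = c * expect p f := by
  simp only [expect, mul_left_comm _ c, ENNReal.tsum_mul_left]

theorem expect_const (p : PMF β) (c : ℝ≥0∞) : expect p (fun _ => c) = c := by
  simp only [expect, ENNReal.tsum_mul_right, p.tsum_coe, one_mul]

theorem expect_mono (p : PMF β) {f g : β → ℝ≥0∞} (h : ∀ b, f b ≤ g b) :
    expect p f ≤ expect p g :=
  ENNReal.tsum_le_tsum fun b => by gcongr; exact h b

theorem prob_eq_toOuterMeasure (p : PMF β) (s : Set β) : prob p s = p.toOuterMeasure s := by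
  rw [PMF.toOuterMeasure_apply, prob, expect]
  refine tsum_congr fun b => ?_
  by_cases hb : b ∈ s <;> simp [hb]

theorem prob_mono (p : PMF β) {s t : Set β} (h : s ⊆ t) : prob p s ≤ prob p t :=
  expect_mono p fun b => Set.indicator_le_indicator_of_subset h (fun _ => zero_le) b

theorem prob_union_le (p : PMF β) (s t : Set β) : prob p (s ∪ t) ≤ prob p s + prob p t := by
  rw [prob, prob, prob, ← expect_add]
  refine expect_mono p fun b => ?_
  by_cases hs : b ∈ s <;> by_cases ht : b ∈ t <;> simp [hs, ht]

theorem prob_compl_add (p : PMF β) (s : Set β) : prob p sᶜ + prob p s = 1 := by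
  rw [prob, prob, ← expect_add, ← expect_const p 1]
  congr 1
  ext b
  by_cases hs : b ∈ s <;> simp [hs]

theorem mul_prob_le_expect (p : PMF β) (f : β → ℝ≥0∞) (c : ℝ≥0∞) :
    c * prob p {b | c ≤ f b} ≤ expect p f := by
  rw [prob, ← expect_const_mul]
  refine expect_mono p fun b => ?_
  by_cases hb : c ≤ f b <;> simp [hb]

/-- If the first stage fails with probability at most `δ`, and the second one fails with
probability at most `δ'` after each success of the first one, then the composition fails with
probability at most `δ + δ'`. -/
theorem prob_bind_le (p : PMF β) (g : β → PMF γ) (bad : Set β) (bad' : Set γ) {δ δ' : ℝ≥0∞}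
    (h : prob p bad ≤ δ) (h' : ∀ b ∉ bad, prob (g b) bad' ≤ δ') :
    prob (p.bind g) bad' ≤ δ + δ' := by
  have h1 : ∀ b, prob (g b) bad' ≤ bad.indicator 1 b + δ' := by
    intro b
    by_cases hb : b ∈ bad
    · have := prob_compl_add (g b) bad'
      have h2 : prob (g b) bad' ≤ 1 := by rw [← this]; exact le_add_self
      simpa [hb] using h2.trans le_self_add
    · simpa [hb] using h' b hb
  calc prob (p.bind g) bad' = expect p fun b => prob (g b) bad' := expect_bind ..
    _ ≤ expect p fun b => bad.indicator 1 b + δ' := expect_mono p h1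
    _ = prob p bad + δ' := by rw [expect_add, expect_const]; rfl
    _ ≤ δ + δ' := by gcongr

theorem unif_apply {k : ℕ} (hk : 0 < k) (i : ℕ) :
    unif k i = if i < k then (k : ℝ≥0∞)⁻¹ else 0 := by
  have hne : (Finset.range (max k 1)).Nonempty := ⟨0, by simp⟩
  have h : unif k i = PMF.uniformOfFinset _ hne i := rfl
  rw [h, PMF.uniformOfFinset_apply, max_eq_left hk]
  simp

theorem expect_unif {k : ℕ} (hk : 0 < k) (f : ℕ → ℝ≥0∞) :
    expect (unif k) f = (k : ℝ≥0∞)⁻¹ * ∑ i ∈ Finset.range k, f i := by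
  rw [expect, tsum_eq_sum (s := Finset.range k), Finset.mul_sum]
  · refine Finset.sum_congr rfl fun i hi => ?_
    rw [unif_apply hk, if_pos (Finset.mem_range.1 hi)]
  · intro i hi
    rw [unif_apply hk, if_neg (by simpa using hi), zero_mul]

theorem lt_of_mem_support_unif {k i : ℕ} (hk : 0 < k) (hi : i ∈ (unif k).support) : i < k := by
  by_contra h
  exact (PMF.mem_support_iff _ _).1 hi (by rw [unif_apply hk, if_neg h])

end Expect

/-! ### Sums of independent samples -/

/-- The distribution of the state of a Markov chain with transition law `step`, started in `b`,
after the given number of steps. -/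
def iterStep {β : Type*} (step : β → PMF β) : ℕ → β → PMF β
  | 0, b => PMF.pure b
  | r + 1, b => (step b).bind (iterStep step r)

/-- The distribution of `b` plus the sum of `r` independent samples from `q`. -/
def sumLaw (q : PMF ℕ) (r b : ℕ) : PMF ℕ := iterStep (fun c => q.map (c + ·)) r b

theorem sumLaw_succ (q : PMF ℕ) (r b : ℕ) :
    sumLaw q (r + 1) b = q.bind fun x => sumLaw q r (b + x) := by
  rw [sumLaw, iterStep, PMF.bind_map]
  rfl

theorem expect_sumLaw (q : PMF ℕ) {μ : ℝ≥0∞} (hμ : expect q (fun x => (x : ℝ≥0∞)) = μ)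
    (r b : ℕ) : expect (sumLaw q r b) (fun x => (x : ℝ≥0∞)) = b + r * μ := by
  induction r generalizing b with
  | zero => simp [sumLaw, iterStep, expect_pure]
  | succ r ih =>
    simp only [sumLaw_succ, expect_bind, ih, Nat.cast_add, expect_add, expect_const, hμ]
    push_cast
    ring

theorem expect_sumLaw_sq_le (q : PMF ℕ) {μ M : ℝ≥0∞}
    (hμ : expect q (fun x => (x : ℝ≥0∞)) = μ) (hM : expect q (fun x => (x : ℝ≥0∞) ^ 2) ≤ M)
    (r b : ℕ) : expect (sumLaw q r b) (fun x => (x : ℝ≥0∞) ^ 2) ≤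
      b ^ 2 + 2 * b * (r * μ) + r * M + (r * μ) ^ 2 := by
  induction r generalizing b with
  | zero => simp [sumLaw, iterStep, expect_pure]
  | succ r ih =>
    rw [sumLaw_succ, expect_bind]
    calc _ ≤ expect q fun x => ((x : ℝ≥0∞) ^ 2 + (2 * b + 2 * (r * μ)) * x) +
          (b ^ 2 + 2 * b * (r * μ) + r * M + (r * μ) ^ 2) := by
          refine expect_mono q fun x => (ih (b + x)).trans (le_of_eq ?_)
          push_cast
          ring
      _ ≤ (M + (2 * b + 2 * (r * μ)) * μ) +
          (b ^ 2 + 2 * b * (r * μ) + r * M + (r * μ) ^ 2) := by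
          rw [expect_add, expect_add, expect_const_mul, expect_const, hμ]
          gcongr
      _ ≤ (M + (2 * b + 2 * (r * μ)) * μ) +
          (b ^ 2 + 2 * b * (r * μ) + r * M + (r * μ) ^ 2) + μ ^ 2 := le_self_add
      _ = _ := by
          push_cast
          ring

/-- **Chebyshev's inequality** for the sum of `r` independent samples, where `M` bounds the second
moment of one sample. -/
theorem prob_sumLaw_deviation_le (q : PMF ℕ) {μ M t δ : ℝ} (hμ0 : 0 ≤ μ) (ht : 0 < t)
    (hμ : expect q (fun x => (x : ℝ≥0∞)) = ENNReal.ofReal μ)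
    (hM : expect q (fun x => (x : ℝ≥0∞) ^ 2) ≤ ENNReal.ofReal M) (r : ℕ)
    (h : r * M ≤ δ * t ^ 2) :
    prob (sumLaw q r 0) {S | t ≤ |(S : ℝ) - r * μ|} ≤ ENNReal.ofReal δ := by
  set a : ℝ := r * μ with ha
  have ha0 : 0 ≤ a := by positivity
  have hcast : ∀ x : ℕ, (x : ℝ≥0∞) = ENNReal.ofReal x := fun x => by simp
  have har : (r : ℝ≥0∞) * ENNReal.ofReal μ = ENNReal.ofReal a := by
    rw [ha, ENNReal.ofReal_mul (by positivity), ← hcast]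
  -- `(S - a)² + 2aS = S² + a²` has only nonnegative terms
  have key : expect (sumLaw q r 0) (fun x => ENNReal.ofReal (((x : ℝ) - a) ^ 2)) +
      ENNReal.ofReal (2 * a * a) ≤
      ENNReal.ofReal (r * M) + ENNReal.ofReal (2 * a * a) := by
    have h1 := expect_sumLaw q hμ r 0
    have h2 := expect_sumLaw_sq_le q hμ hM r 0
    rw [har] at h1 h2
    calc _ = expect (sumLaw q r 0) (fun x => ENNReal.ofReal (((x : ℝ) - a) ^ 2) +
            ENNReal.ofReal (2 * a) * x) := by
          rw [expect_add, expect_const_mul, h1, ENNReal.ofReal_mul (by positivity)]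
          simp
      _ = expect (sumLaw q r 0) (fun x => (x : ℝ≥0∞) ^ 2 + ENNReal.ofReal (a ^ 2)) := by
          congr 1
          ext x
          rw [hcast, ← ENNReal.ofReal_mul (by positivity),
            ← ENNReal.ofReal_add (by positivity) (by positivity),
            ← ENNReal.ofReal_pow (by positivity),
            ← ENNReal.ofReal_add (by positivity) (by positivity)]
          congr 1
          ring
      _ ≤ (r * ENNReal.ofReal M + ENNReal.ofReal a ^ 2) + ENNReal.ofReal (a ^ 2) := by
          rw [expect_add, expect_const]
          gcongr
          simpa using h2
      _ = _ := by
          rw [hcast, ← ENNReal.ofReal_mul (by positivity), ← ENNReal.ofReal_pow ha0, add_assoc,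
            ← ENNReal.ofReal_add (by positivity) (by positivity)]
          congr 2
          ring
  have hV := (ENNReal.add_le_add_iff_right ENNReal.ofReal_ne_top).1 key
  have ht2 : 0 < t ^ 2 := by positivity
  have hmarkov := mul_prob_le_expect (sumLaw q r 0)
    (fun x => ENNReal.ofReal (((x : ℝ) - a) ^ 2)) (ENNReal.ofReal (t ^ 2))
  have hset : {S : ℕ | t ≤ |(S : ℝ) - a|} ⊆
      {x | ENNReal.ofReal (t ^ 2) ≤ ENNReal.ofReal (((x : ℝ) - a) ^ 2)} := by
    intro S hS
    apply ENNReal.ofReal_le_ofReal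
    rw [← sq_abs ((S : ℝ) - a)]
    exact pow_le_pow_left₀ ht.le hS 2
  refine (prob_mono _ hset).trans ?_
  have h3 := (hmarkov.trans hV).trans (ENNReal.ofReal_le_ofReal h)
  rw [mul_comm δ, ENNReal.ofReal_mul ht2.le] at h3
  exact (ENNReal.mul_le_mul_iff_right (by simpa using ht.ne') ENNReal.ofReal_ne_top).1 h3

/-- **Markov's inequality** for the sum of `r` independent samples. -/
theorem prob_sumLaw_ge_le (q : PMF ℕ) {μ t δ : ℝ} (ht : 0 < t)
    (hμ : expect q (fun x => (x : ℝ≥0∞)) = ENNReal.ofReal μ) (r : ℕ) (h : r * μ ≤ δ * t) :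
    prob (sumLaw q r 0) {S | t ≤ (S : ℝ)} ≤ ENNReal.ofReal δ := by
  have h1 := expect_sumLaw q hμ r 0
  have h2 := mul_prob_le_expect (sumLaw q r 0) (fun x => (x : ℝ≥0∞)) (ENNReal.ofReal t)
  have hset : {S : ℕ | t ≤ (S : ℝ)} ⊆ {x : ℕ | ENNReal.ofReal t ≤ (x : ℝ≥0∞)} := by
    intro S hS
    have := ENNReal.ofReal_le_ofReal (show t ≤ (S : ℝ) from hS)
    simpa using this
  refine (prob_mono _ hset).trans ?_
  have h3 : ((0 : ℕ) : ℝ≥0∞) + r * ENNReal.ofReal μ ≤ ENNReal.ofReal (t * δ) := by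
    rw [show (r : ℝ≥0∞) = ENNReal.ofReal r by simp, ← ENNReal.ofReal_mul (by positivity)]
    simpa [mul_comm δ] using ENNReal.ofReal_le_ofReal h
  rw [← h1] at h3
  have h4 := h2.trans h3
  rw [ENNReal.ofReal_mul ht.le] at h4
  exact (ENNReal.mul_le_mul_iff_right (by simpa using ht) ENNReal.ofReal_ne_top).1 h4

/-- Smaller samples make a small sum more likely. -/
theorem prob_sumLaw_map_lt_mono {β : Type*} (q : PMF β) {f g : β → ℕ} (hfg : ∀ x, g x ≤ f x)
    (t : ℝ) (r : ℕ) {b c : ℕ} (hbc : c ≤ b) :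
    prob (sumLaw (q.map f) r b) {S | (S : ℝ) < t} ≤
      prob (sumLaw (q.map g) r c) {S | (S : ℝ) < t} := by
  induction r generalizing b c with
  | zero =>
    simp only [sumLaw, iterStep, prob, expect_pure]
    by_cases hb : (b : ℝ) < t
    · have hc : (c : ℝ) < t := lt_of_le_of_lt (by exact_mod_cast hbc) hb
      simp [hb, hc]
    · simp [hb]
  | succ r ih =>
    simp only [prob] at ih ⊢
    simp only [sumLaw_succ, expect_bind, expect_map]
    exact expect_mono q fun x => ih (Nat.add_le_add hbc (hfg x))

/-! ### Couplings between runs of programs and abstract distributions -/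

/-- The run with outcome distribution `p` always halts, and its final state can be coupled with a
sample from `q` such that the two are always related by `R`. -/
def Simulates {β : Type*} (p : PMF (Option State)) (q : PMF β) (R : β → State → Prop) : Prop :=
  ∃ c : PMF (β × State), c.map Prod.fst = q ∧ c.map (fun x => some x.2) = p ∧
    ∀ x ∈ c.support, R x.1 x.2

namespace Simulates

variable {β γ : Type*}

theorem pure {R : β → State → Prop} {b : β} {s : State} (h : R b s) :
    Simulates (PMF.pure (some s)) (PMF.pure b) R :=
  ⟨PMF.pure (b, s), PMF.pure_map .., PMF.pure_map .., by simp [h]⟩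

theorem bind_congr_support {α' : Type*} (p : PMF α') {f g : α' → PMF γ}
    (h : ∀ a ∈ p.support, f a = g a) : p.bind f = p.bind g := by
  ext b
  simp only [PMF.bind_apply]
  refine tsum_congr fun a => ?_
  by_cases ha : p a = 0
  · simp [ha]
  · rw [h a ((PMF.mem_support_iff _ _).2 ha)]

/-- Both sides start with the same draw. -/
theorem draw {α' : Type*} (p : PMF α') {f : α' → PMF (Option State)} {g : α' → PMF β}
    {R : β → State → Prop} (h : ∀ a ∈ p.support, Simulates (f a) (g a) R) :
    Simulates (p.bind f) (p.bind g) R := by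
  classical
  obtain ⟨a₀, ha₀⟩ := p.support_nonempty
  have h' : ∀ a, ∃ c : PMF (β × State), a ∈ p.support → c.map Prod.fst = g a ∧
      c.map (fun x => some x.2) = f a ∧ ∀ x ∈ c.support, R x.1 x.2 := by
    intro a
    by_cases ha : a ∈ p.support
    · obtain ⟨c, hc⟩ := h a ha
      exact ⟨c, fun _ => hc⟩
    · obtain ⟨c, -⟩ := h a₀ ha₀
      exact ⟨c, fun ha' => absurd ha' ha⟩
  choose c hc using h'
  refine ⟨p.bind c, ?_, ?_, ?_⟩
  · rw [PMF.map_bind]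
    exact bind_congr_support p fun a ha => (hc a ha).1
  · rw [PMF.map_bind]
    exact bind_congr_support p fun a ha => (hc a ha).2.1
  · intro x hx
    obtain ⟨a, ha, hxa⟩ := (PMF.mem_support_bind_iff _ _ _).1 hx
    exact (hc a ha).2.2 x hxa

/-- Sequential composition. -/
theorem bind {p : PMF (Option State)} {q : PMF β} {R : β → State → Prop}
    (h : Simulates p q R) {f : Option State → PMF (Option State)} {g : β → PMF γ}
    {R' : γ → State → Prop} (h' : ∀ b s, R b s → Simulates (f (some s)) (g b) R') :
    Simulates (p.bind f) (q.bind g) R' := by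
  obtain ⟨c, rfl, rfl, hc⟩ := h
  rw [PMF.bind_map, PMF.bind_map]
  exact draw c fun x hx => h' _ _ (hc x hx)

theorem exists_of_mem_support {p : PMF (Option State)} {q : PMF β} {R : β → State → Prop}
    (h : Simulates p q R) {o : Option State} (ho : o ∈ p.support) :
    ∃ b s, o = some s ∧ R b s := by
  obtain ⟨c, -, rfl, hc⟩ := h
  obtain ⟨x, hx, rfl⟩ := (PMF.mem_support_map_iff _ _ _).1 ho
  exact ⟨x.1, x.2, rfl, hc x hx⟩

theorem prob_le {p : PMF (Option State)} {q : PMF β} {R : β → State → Prop}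
    (h : Simulates p q R) {good : Set β} {good' : Set State}
    (hR : ∀ b s, R b s → b ∈ good → s ∈ good') :
    prob q good ≤ prob p {o | ∃ s, o = some s ∧ s ∈ good'} := by
  obtain ⟨c, rfl, rfl, hc⟩ := h
  simp only [prob, expect_map]
  refine ENNReal.tsum_le_tsum fun x => ?_
  by_cases hx : c x = 0
  · simp [hx]
  · gcongr
    have hR' := hR _ _ (hc x ((PMF.mem_support_iff _ _).2 hx))
    by_cases hb : x.1 ∈ good
    · simp [hb, hR' hb]
    · simp [hb]

/-- A loop that stops after exactly `j` rounds, where `I i b s` is an invariant that holds for the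
abstract state `b` and the machine state `s` when `i` rounds are still to be made. -/
theorem iterWhile {a : ℕ} {body : State → PMF (Option State)} {step : β → PMF β}
    {R : β → State → Prop} (I : ℕ → β → State → Prop)
    (hdone : ∀ b s, I 0 b s → s.mem a = 0 ∧ R b s.tick)
    (hbody : ∀ i b s, I (i + 1) b s → s.mem a ≠ 0 ∧ Simulates (body s.tick) (step b) (I i)) :
    ∀ {fuel j : ℕ} {b : β} {s : State}, I j b s → j < fuel →
      Simulates (iterWhile a body fuel s) (iterStep step j b) R := by
  intro fuel
  induction fuel with
  | zero => intro j b s _ h; omega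
  | succ fuel ih =>
    intro j b s hI hj
    cases j with
    | zero =>
      obtain ⟨h0, hR⟩ := hdone b s hI
      simp only [ErasureResilient.iterWhile, h0, if_true, iterStep]
      exact pure hR
    | succ i =>
      obtain ⟨h0, hB⟩ := hbody i b s hI
      simp only [ErasureResilient.iterWhile, h0, if_false, iterStep]
      exact hB.bind fun b' s' hI' => ih hI' (by omega)

end Simulates

/-! ### Computation rules for programs -/

section Run

variable {n : ℕ} (A : ErasedLists n) (fuel : ℕ)

theorem run_seq_const (d c : ℕ) (p : Program) (s : State) :
    Program.run A fuel (.seq (.const d c) p) s = Program.run A fuel p (s.tick.write d c) := by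
  simp [Program.run]

theorem run_seq_arith (o : ArithOp) (d a b : ℕ) (p : Program) (s : State) :
    Program.run A fuel (.seq (.arith o d a b) p) s =
      Program.run A fuel p (s.tick.write d (o.eval (s.mem a) (s.mem b))) := by
  simp [Program.run]

theorem run_seq_degree (d a : ℕ) (p : Program) (s : State) :
    Program.run A fuel (.seq (.degree d a) p) s =
      Program.run A fuel p (s.tick.ask.write d (degreeOf A (s.mem a))) := by
  simp [Program.run]

theorem run_seq_rand (d a : ℕ) (p : Program) (s : State) :
    Program.run A fuel (.seq (.rand d a) p) s =
      (unif (s.mem a)).bind fun x => Program.run A fuel p (s.tick.write d x) := by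
  simp only [Program.run, PMF.bind_map]
  rfl

theorem run_seq_neighbor (d a : ℕ) (p : Program) (s : State) :
    Program.run A fuel (.seq (.neighbor d a) p) s =
      (randomNeighbor A (s.mem a)).bind fun x =>
        Program.run A fuel p (s.tick.ask.write d x) := by
  simp only [Program.run, PMF.bind_map]
  rfl

theorem run_arith (o : ArithOp) (d a b : ℕ) (s : State) :
    Program.run A fuel (.arith o d a b) s =
      PMF.pure (some (s.tick.write d (o.eval (s.mem a) (s.mem b)))) := by
  simp [Program.run]

theorem run_while (a : ℕ) (p : Program) (s : State) :
    Program.run A fuel (.while a p) s = iterWhile a (Program.run A fuel p) fuel s := by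
  simp [Program.run]

theorem simulates_seq {β γ : Type*} {p r : Program} {s : State} {q : PMF β} {g : β → PMF γ}
    {R : β → State → Prop} {R' : γ → State → Prop}
    (h : Simulates (Program.run A fuel p s) q R)
    (h' : ∀ b s', R b s' → Simulates (Program.run A fuel r s') (g b) R') :
    Simulates (Program.run A fuel (.seq p r) s) (q.bind g) R' := by
  simp only [Program.run]
  exact h.bind fun b s' hs' => h' b s' hs'

end Run

/-! ### Sums over the entries of the adjacency lists -/

/-- A completion of the lists `A` to the graph `H`, with the two parts of `IsCompletion` named. -/
structure Completes {n : ℕ} (A : ErasedLists n) (H : SimpleGraph (Fin n))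
    (L : Fin n → List (Fin n)) : Prop where
  lists : IsAdjLists H L
  entries : ∀ v, List.Forall₂ (fun a b => a = none ∨ a = some b) (A v) (L v)

/-- The number by which the oracles name an entry. -/
def code {n : ℕ} : Option (Fin n) → ℕ
  | none => n
  | some u => u

open Classical in
/-- What is left of the entry for the neighbor `u` in the list of `v`. -/
def visible {n : ℕ} (A : ErasedLists n) (v u : Fin n) : Option (Fin n) :=
  if some u ∈ A v then some u else none

open Classical in
/-- The sum of `W v u` over the ordered pairs of adjacent vertices. -/
def pairSum {n : ℕ} (H : SimpleGraph (Fin n)) (W : Fin n → Fin n → ℕ) : ℕ :=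
  ∑ v, ∑ u, if H.Adj v u then W v u else 0

open Classical in
theorem sum_map_eq_of_forall₂ {V M : Type*} [AddCommMonoid M] (f : Option V → M)
    {a : List (Option V)} {l : List V}
    (h : List.Forall₂ (fun a b => a = none ∨ a = some b) a l) (hl : l.Nodup) :
    (a.map f).sum = (l.map fun u => f (if some u ∈ a then some u else none)).sum := by
  have hmem : ∀ {a : List (Option V)} {l : List V},
      List.Forall₂ (fun a b => a = none ∨ a = some b) a l → ∀ u, some u ∈ a → u ∈ l := by
    intro a l h
    induction h with
    | nil => simp
    | cons hab _ ih =>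
      intro u hu
      rcases List.mem_cons.1 hu with rfl | hu
      · simp_all
      · exact List.mem_cons_of_mem _ (ih u hu)
  induction h with
  | nil => simp
  | @cons o b as bs hab hrest ih =>
    obtain ⟨hb, hbs⟩ := List.nodup_cons.1 hl
    rw [List.map_cons, List.map_cons, List.sum_cons, List.sum_cons, ih hbs]
    congr 1
    · rcases hab with rfl | rfl
      · have : some b ∉ as := fun hc => hb (hmem hrest b hc)
        simp [this]
      · simp
    · congr 1
      refine List.map_congr_left fun u hu => ?_
      have hne : u ≠ b := fun h => hb (h ▸ hu)
      have : some u ∈ o :: as ↔ some u ∈ as := by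
        rcases hab with rfl | rfl <;> simp [hne]
      simp only [this]

namespace Completes

variable {n : ℕ} {A : ErasedLists n} {H : SimpleGraph (Fin n)} {L : Fin n → List (Fin n)}

open Classical in
/-- A sum over the list of `v` is a sum over the neighbors of `v`. -/
theorem sum_map (h : Completes A H L) {M : Type*} [AddCommMonoid M] (f : Option (Fin n) → M)
    (v : Fin n) : ((A v).map f).sum = ∑ u, if H.Adj v u then f (visible A v u) else 0 := by
  rw [sum_map_eq_of_forall₂ f (h.entries v) (h.lists v).1, ← List.sum_toFinset _ (h.lists v).1,
    ← Finset.sum_filter]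
  refine Finset.sum_congr ?_ fun u _ => by rw [visible]; congr
  ext u
  simp [(h.lists v).2 u]

open Classical in
theorem length_eq (h : Completes A H L) (v : Fin n) :
    (A v).length = ∑ u, if H.Adj v u then 1 else 0 := by
  rw [← h.sum_map (fun _ => 1) v, List.map_const', List.sum_replicate]
  simp

theorem numEntries_eq (h : Completes A H L) : numEntries A = pairSum H fun _ _ => 1 := by
  simp only [numEntries, pairSum, h.length_eq]

open Classical in
theorem numErased_eq (h : Completes A H L) :
    numErased A = pairSum H fun v u => if visible A v u = none then 1 else 0 := by
  rw [numErased, pairSum]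
  refine Finset.sum_congr rfl fun v _ => ?_
  rw [← h.sum_map (fun o => if o = none then 1 else 0) v]
  induction A v with
  | nil => simp
  | cons o l ih => by_cases ho : o = none <;> simp [ho, ih, add_comm]

theorem length_le (h : Completes A H L) (v : Fin n) : (A v).length ≤ n := by
  rw [(h.entries v).length_eq]
  simpa using (h.lists v).1.length_le_card

end Completes

/-! ### Counting pairs of adjacent vertices -/

section Pairs

variable {n : ℕ} {A : ErasedLists n} {H : SimpleGraph (Fin n)} {L : Fin n → List (Fin n)}

theorem pairSum_add (W U : Fin n → Fin n → ℕ) :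
    pairSum H (fun v u => W v u + U v u) = pairSum H W + pairSum H U := by
  simp only [pairSum, ← Finset.sum_add_distrib]
  refine Finset.sum_congr rfl fun v _ => Finset.sum_congr rfl fun u _ => ?_
  split_ifs <;> rfl

theorem pairSum_const_mul (c : ℕ) (W : Fin n → Fin n → ℕ) :
    pairSum H (fun v u => c * W v u) = c * pairSum H W := by
  simp only [pairSum, Finset.mul_sum, mul_ite, mul_zero]

theorem pairSum_swap (W : Fin n → Fin n → ℕ) :
    pairSum H (fun v u => W u v) = pairSum H W := by
  rw [pairSum, Finset.sum_comm, pairSum]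
  refine Finset.sum_congr rfl fun v _ => Finset.sum_congr rfl fun u _ => ?_
  by_cases hvu : H.Adj v u
  · simp [hvu, hvu.symm]
  · simpa [hvu] using fun h : H.Adj u v => absurd h.symm hvu

/-- Two sums over ordered pairs can be compared edge by edge. -/
theorem pairSum_le_of_symm {W U : Fin n → Fin n → ℕ}
    (h : ∀ v u, H.Adj v u → W v u + W u v ≤ U v u + U u v) : pairSum H W ≤ pairSum H U := by
  have h2 : pairSum H (fun v u => W v u + W u v) ≤ pairSum H (fun v u => U v u + U u v) := by
    refine Finset.sum_le_sum fun v _ => Finset.sum_le_sum fun u _ => ?_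
    split_ifs with hvu
    · exact h v u hvu
    · exact le_rfl
  rw [pairSum_add, pairSum_add, pairSum_swap W, pairSum_swap U] at h2
  omega

/-- If every edge that does not lie inside `S` gets a total weight of at least `2`, then at most
`|S|²` is missing from the number of ordered pairs. -/
theorem pairSum_one_le (S : Finset (Fin n)) {W : Fin n → Fin n → ℕ}
    (h : ∀ v u, H.Adj v u → ¬ (v ∈ S ∧ u ∈ S) → 2 ≤ W v u + W u v) :
    pairSum H (fun _ _ => 1) ≤ pairSum H W + S.card ^ 2 := by
  have h1 : pairSum H (fun _ _ => 1) ≤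
      pairSum H (fun v u => W v u + if v ∈ S ∧ u ∈ S then 1 else 0) := by
    refine pairSum_le_of_symm fun v u hvu => ?_
    by_cases hS : v ∈ S ∧ u ∈ S
    · simp only [hS, and_self, if_true]
      omega
    · have := h v u hvu hS
      omega
  rw [pairSum_add] at h1
  refine h1.trans (Nat.add_le_add_left ?_ _)
  calc _ ≤ ∑ v, ∑ u, (if v ∈ S then 1 else 0) * (if u ∈ S then 1 else 0) := by
        refine Finset.sum_le_sum fun v _ => Finset.sum_le_sum fun u _ => ?_
        by_cases hv : v ∈ S <;> by_cases hu : u ∈ S <;> simp [hv, hu]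
        split_ifs <;> simp
    _ = S.card ^ 2 := by
        simp [sq]

theorem card_sq_mul_le (S : Finset (Fin n)) {c : ℝ} (h : ∀ v ∈ S, c ≤ ((A v).length : ℝ) ^ 2) :
    (S.card : ℝ) ^ 2 * c ≤ (numEntries A : ℝ) ^ 2 := by
  rcases le_or_gt c 0 with hc | hc
  · exact (mul_nonpos_of_nonneg_of_nonpos (by positivity) hc).trans (by positivity)
  have h1 : (S.card : ℝ) * √c ≤ numEntries A := by
    rw [← nsmul_eq_mul]
    calc S.card • √c ≤ ∑ v ∈ S, ((A v).length : ℝ) :=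
          Finset.card_nsmul_le_sum _ _ _ fun v hv => Real.sqrt_le_iff.2 ⟨by positivity, h v hv⟩
      _ ≤ ∑ v, ((A v).length : ℝ) :=
          Finset.sum_le_sum_of_subset_of_nonneg (Finset.subset_univ _) fun _ _ _ => by positivity
      _ = numEntries A := by simp [numEntries]
  have h2 := pow_le_pow_left₀ (by positivity) h1 2
  rwa [mul_pow, Real.sq_sqrt hc.le] at h2

open Classical in
/-- A vertex has at most `√(2m)` neighbors whose degree is not smaller than its own. -/
theorem Completes.card_upper_sq_le (h : Completes A H L) (v : Fin n) :
    (Finset.univ.filter fun u => H.Adj v u ∧ (A v).length ≤ (A u).length).card ^ 2 ≤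
      numEntries A := by
  set S := Finset.univ.filter fun u => H.Adj v u ∧ (A v).length ≤ (A u).length with hS
  have h1 : S.card ≤ (A v).length := by
    rw [h.length_eq v, ← Finset.card_filter]
    exact Finset.card_le_card fun u hu => by
      simp only [hS, Finset.mem_filter] at hu ⊢
      exact ⟨hu.1, hu.2.1⟩
  calc S.card ^ 2 ≤ S.card • (A v).length := by
        rw [sq, smul_eq_mul]
        exact Nat.mul_le_mul_left _ h1
    _ ≤ ∑ u ∈ S, (A u).length := Finset.card_nsmul_le_sum _ _ _ fun u hu => by
        simp only [hS, Finset.mem_filter] at hu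
        exact hu.2.2
    _ ≤ numEntries A := Finset.sum_le_sum_of_subset (Finset.subset_univ _)

theorem Completes.length_pos (h : Completes A H L) {v u : Fin n} (hvu : H.Adj v u) :
    0 < (A v).length := by
  rw [(h.entries v).length_eq]
  exact List.length_pos_of_mem (((h.lists v).2 u).2 hvu)

end Pairs

/-! ### The estimator -/

section Estimator

variable {n : ℕ} (A : ErasedLists n)

/-- The weight of the entry `u` of the list of `v`. An entry that is a vertex has weight `2`, `1` or
`0` if its degree is larger than, equal to or smaller than that of `v`, so that the two entries of
an edge have total weight `2`. An erased entry has weight `2` if `v` is light, that is,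
`ρ (deg v)² ≤ θ`, and otherwise `0`. All subtractions are truncated. -/
def entryWeight (ρ θ v u : ℕ) : ℕ :=
  (2 - (2 - (degreeOf A u + 1 - degreeOf A v))) +
    (1 - (degreeOf A v * degreeOf A v * ρ - θ)) * (1 - (n - u)) * 2

/-- The estimate of the average degree from the entry `u` of the list of `v`. -/
def estimate (ρ θ v u : ℕ) : ℕ := entryWeight A ρ θ v u * degreeOf A v

/-- The distribution of the estimate from a uniformly random entry of the list of a uniformly
random vertex. -/
def estimateLaw (ρ θ : ℕ) : PMF ℕ :=
  (unif n).bind fun v => (randomNeighbor A v).map (estimate A ρ θ v)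

theorem degreeOf_fin (v : Fin n) : degreeOf A v = (A v).length := by
  simp [degreeOf]

/-- The oracle answers `0` to a degree query to `⊥`. -/
theorem degreeOf_self : degreeOf A n = 0 := by
  simp [degreeOf]

theorem entryWeight_none (ρ θ : ℕ) (v : Fin n) :
    entryWeight A ρ θ v (code (none : Option (Fin n))) =
      (1 - (A v).length) + 2 * (1 - ((A v).length * (A v).length * ρ - θ)) := by
  simp only [entryWeight, code, degreeOf_self, degreeOf_fin]
  rw [Nat.sub_self, Nat.sub_zero, mul_one, mul_comm _ 2]
  omega

theorem entryWeight_some (ρ θ : ℕ) (v u : Fin n) :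
    entryWeight A ρ θ v (code (some u)) = 2 - (2 - ((A u).length + 1 - (A v).length)) := by
  have h : 1 - (n - (u : ℕ)) = 0 := by omega
  simp only [entryWeight, code, degreeOf_fin, h]
  simp

theorem entryOf_eq_code (v : Fin n) (i : Fin (A v).length) :
    entryOf A v i = code ((A v)[i.1]) := by
  simp only [entryOf, v.2, dif_pos, Fin.eta, i.2, List.getElem?_eq_getElem]
  cases (A v)[i.1] <;> rfl

/-- The factor `deg v` cancels the probability `1 / deg v` of an entry; both sides are `0` if the
list is empty. -/
theorem expect_randomNeighbor (v : Fin n) (g : ℕ → ℝ≥0∞) :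
    expect (randomNeighbor A v) (fun u => degreeOf A v * g u) =
      ((A v).map fun o => g (code o)).sum := by
  rw [expect_const_mul, randomNeighbor, expect_map, degreeOf_fin]
  rcases Nat.eq_zero_or_pos (A v).length with h0 | hpos
  · simp [List.length_eq_zero_iff.1 h0]
  · rw [expect_unif hpos, ← mul_assoc, ENNReal.mul_inv_cancel (by simpa using hpos.ne')
      (ENNReal.natCast_ne_top _), one_mul, Finset.sum_range]
    simp only [entryOf_eq_code]
    rw [← Fin.sum_univ_fun_getElem]

theorem expect_unif_fin (hn : 0 < n) (f : ℕ → ℝ≥0∞) :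
    expect (unif n) f = (n : ℝ≥0∞)⁻¹ * ∑ v : Fin n, f v := by
  rw [expect_unif hn, Finset.sum_range]

end Estimator

section Moments

variable {n : ℕ} {A : ErasedLists n} {H : SimpleGraph (Fin n)} {L : Fin n → List (Fin n)}

/-- The weight of the entry for the neighbor `u` in the list of `v`. -/
def pairWeight (A : ErasedLists n) (ρ θ : ℕ) (v u : Fin n) : ℕ :=
  entryWeight A ρ θ v (code (visible A v u))

theorem ofReal_natCast_div (hn : 0 < n) (x : ℕ) :
    ENNReal.ofReal ((x : ℝ) / n) = (n : ℝ≥0∞)⁻¹ * x := by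
  rw [ENNReal.ofReal_div_of_pos (by exact_mod_cast hn), ENNReal.div_eq_inv_mul]
  simp

theorem Completes.expect_estimateLaw (h : Completes A H L) (hn : 0 < n) (ρ θ : ℕ) :
    expect (estimateLaw A ρ θ) (fun x => (x : ℝ≥0∞)) =
      ENNReal.ofReal ((pairSum H (pairWeight A ρ θ) : ℝ) / n) := by
  rw [ofReal_natCast_div hn, estimateLaw, expect_bind, expect_unif_fin hn]
  congr 1
  rw [pairSum, Nat.cast_sum]
  refine Finset.sum_congr rfl fun v _ => ?_
  rw [expect_map]
  simp only [estimate, Nat.cast_mul]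
  simp_rw [mul_comm _ (degreeOf A v : ℝ≥0∞)]
  rw [expect_randomNeighbor A v fun u => (entryWeight A ρ θ v u : ℝ≥0∞), h.sum_map]
  push_cast
  rfl

theorem Completes.expect_estimateLaw_sq (h : Completes A H L) (hn : 0 < n) (ρ θ : ℕ) :
    expect (estimateLaw A ρ θ) (fun x => (x : ℝ≥0∞) ^ 2) =
      ENNReal.ofReal
        ((pairSum H (fun v u => (A v).length * pairWeight A ρ θ v u ^ 2) : ℝ) / n) := by
  rw [ofReal_natCast_div hn, estimateLaw, expect_bind, expect_unif_fin hn]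
  congr 1
  rw [pairSum, Nat.cast_sum]
  refine Finset.sum_congr rfl fun v _ => ?_
  rw [expect_map]
  have h1 : ∀ u, ((estimate A ρ θ v u : ℕ) : ℝ≥0∞) ^ 2 =
      degreeOf A v * ((degreeOf A v * entryWeight A ρ θ v u ^ 2 : ℕ) : ℝ≥0∞) := by
    intro u
    rw [estimate]
    push_cast
    ring
  simp only [h1]
  rw [expect_randomNeighbor A v fun u =>
    ((degreeOf A v * entryWeight A ρ θ v u ^ 2 : ℕ) : ℝ≥0∞), h.sum_map]
  push_cast
  simp only [degreeOf_fin]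
  rfl

theorem one_sub_sub_eq (a b : ℕ) : 1 - (a - b) = if a ≤ b then 1 else 0 := by
  split_ifs <;> omega

theorem pairWeight_add_ge {ρ θ : ℕ} {v u : Fin n}
    (hlight : (A v).length * (A v).length * ρ ≤ θ ∨
      (A u).length * (A u).length * ρ ≤ θ) :
    2 ≤ pairWeight A ρ θ v u + pairWeight A ρ θ u v := by
  have hlt : ∀ {x y : Fin n}, (A x).length * (A x).length * ρ ≤ θ →
      ¬ (A y).length * (A y).length * ρ ≤ θ → (A x).length < (A y).length := by
    intro x y hx hy
    by_contra hc
    have hc := not_lt.1 hc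
    exact hy ((Nat.mul_le_mul_right ρ (Nat.mul_le_mul hc hc)).trans hx)
  have h1 := @hlt v u
  have h2 := @hlt u v
  simp only [pairWeight, visible]
  split_ifs <;>
    simp only [entryWeight_none, entryWeight_some, one_sub_sub_eq ((A v).length * _ * _),
      one_sub_sub_eq ((A u).length * _ * _)] <;>
    (try split_ifs) <;> omega

open Classical in
theorem Completes.pairWeight_add_le (h : Completes A H L) (ρ θ : ℕ) {v u : Fin n}
    (hvu : H.Adj v u) : pairWeight A ρ θ v u + pairWeight A ρ θ u v ≤
      (2 + 2 * (if visible A v u = none then 1 else 0) +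
        2 * if visible A u v = none then 1 else 0) := by
  have hv := h.length_pos hvu
  have hu := h.length_pos hvu.symm
  simp only [pairWeight, visible]
  split_ifs <;>
    simp only [entryWeight_none, entryWeight_some] <;> simp_all <;> omega

theorem Completes.pairWeight_le (h : Completes A H L) (ρ θ : ℕ) {v u : Fin n}
    (hvu : H.Adj v u) : pairWeight A ρ θ v u ≤ 2 := by
  have hv := h.length_pos hvu
  simp only [pairWeight, visible]
  split_ifs <;> simp only [entryWeight_none, entryWeight_some] <;> omega

/-- The total weight exceeds the number of entries by at most a factor `1 + 2 min(α, 1/2)`. -/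
theorem Completes.pairSum_pairWeight_le (h : Completes A H L) {α : ℝ}
    (hα : (numErased A : ℝ) ≤ α * numEntries A) (ρ θ : ℕ) :
    (pairSum H (pairWeight A ρ θ) : ℝ) ≤ (1 + 2 * min α (1 / 2)) * numEntries A := by
  classical
  have h1 : pairSum H (pairWeight A ρ θ) ≤ numEntries A + 2 * numErased A := by
    rw [h.numEntries_eq, h.numErased_eq, ← pairSum_const_mul, ← pairSum_add]
    refine pairSum_le_of_symm fun v u hvu => ?_
    have := h.pairWeight_add_le ρ θ hvu
    omega
  have h2 : pairSum H (pairWeight A ρ θ) ≤ 2 * numEntries A := by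
    rw [h.numEntries_eq, ← pairSum_const_mul]
    refine pairSum_le_of_symm fun v u hvu => ?_
    have := h.pairWeight_le ρ θ hvu
    have := h.pairWeight_le ρ θ hvu.symm
    omega
  have h1' : (pairSum H (pairWeight A ρ θ) : ℝ) ≤ numEntries A + 2 * numErased A := by
    exact_mod_cast h1
  have h2' : (pairSum H (pairWeight A ρ θ) : ℝ) ≤ 2 * numEntries A := by exact_mod_cast h2
  rcases min_choice α (1 / 2) with hm | hm <;> rw [hm] <;> linarith

/-- Only edges between two heavy vertices can get a weight below `2`. -/
theorem Completes.le_pairSum_pairWeight (h : Completes A H L) {ρ θ : ℕ} {c : ℝ}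
    (hc : ∀ d : ℕ, θ < d * d * ρ → c ≤ (d : ℝ) ^ 2) (hc0 : 0 < c) :
    (numEntries A : ℝ) - (numEntries A : ℝ) ^ 2 / c ≤ pairSum H (pairWeight A ρ θ) := by
  classical
  set S := Finset.univ.filter fun v => θ < (A v).length * (A v).length * ρ with hS
  have h1 : numEntries A ≤ pairSum H (pairWeight A ρ θ) + S.card ^ 2 := by
    rw [h.numEntries_eq]
    refine pairSum_one_le S fun v u hvu hvuS => pairWeight_add_ge ?_
    simp only [hS, Finset.mem_filter, Finset.mem_univ, true_and] at hvuS
    omega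
  have h2 : (S.card : ℝ) ^ 2 ≤ (numEntries A : ℝ) ^ 2 / c := by
    rw [le_div_iff₀ hc0]
    refine card_sq_mul_le S fun v hv => hc _ ?_
    simpa [hS] using hv
  have h1' : (numEntries A : ℝ) ≤ pairSum H (pairWeight A ρ θ) + (S.card : ℝ) ^ 2 := by
    exact_mod_cast h1
  linarith

/-- A light vertex has at most `K` entries, and the list of a heavy vertex has at most `√(2m)`
entries of nonzero weight. -/
theorem Completes.pairSum_sq_le (h : Completes A H L) {ρ θ : ℕ} {K : ℝ}
    (hK : ∀ d : ℕ, d * d * ρ ≤ θ → (d : ℝ) ≤ K) (hK' : √(numEntries A) ≤ K) :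
    (pairSum H (fun v u => (A v).length * pairWeight A ρ θ v u ^ 2) : ℝ) ≤
      4 * K * numEntries A := by
  classical
  have h1 : ∀ v, ((∑ u, if H.Adj v u then pairWeight A ρ θ v u ^ 2 else 0 : ℕ) : ℝ) ≤
      4 * K := by
    intro v
    set S := Finset.univ.filter fun u => H.Adj v u ∧ pairWeight A ρ θ v u ≠ 0 with hS
    have h2 : (∑ u, if H.Adj v u then pairWeight A ρ θ v u ^ 2 else 0) ≤ 4 * S.card := by
      rw [hS, Finset.card_filter, Finset.mul_sum]
      refine Finset.sum_le_sum fun u _ => ?_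
      by_cases hvu : H.Adj v u
      · have h3 := h.pairWeight_le ρ θ hvu
        generalize pairWeight A ρ θ v u = w at h3
        interval_cases w <;> simp [hvu]
      · simp [hvu]
    have h3 : (S.card : ℝ) ≤ K := by
      by_cases hl : (A v).length * (A v).length * ρ ≤ θ
      · refine le_trans ?_ (hK _ hl)
        rw [h.length_eq v, ← Finset.card_filter]
        exact_mod_cast Finset.card_le_card fun u hu => by
          simp only [hS, Finset.mem_filter] at hu ⊢
          exact ⟨hu.1, hu.2.1⟩
      · refine le_trans (Real.le_sqrt_of_sq_le ?_) hK'
        refine le_trans ?_ (Nat.cast_le.2 (h.card_upper_sq_le v))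
        push_cast
        gcongr
        intro u hu
        simp only [hS, Finset.mem_filter] at hu ⊢
        obtain ⟨hu0, hvu, hw⟩ := hu
        refine ⟨hu0, hvu, ?_⟩
        have hpos := h.length_pos hvu
        by_contra hlt
        apply hw
        simp only [pairWeight, visible]
        split_ifs
        · rw [entryWeight_some]
          omega
        · rw [entryWeight_none, one_sub_sub_eq, if_neg hl]
          omega
    calc _ ≤ ((4 * S.card : ℕ) : ℝ) := by exact_mod_cast h2
      _ ≤ 4 * K := by push_cast; linarith
  calc (pairSum H (fun v u => (A v).length * pairWeight A ρ θ v u ^ 2) : ℝ)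
      = ∑ v, ((A v).length : ℝ) *
          ((∑ u, if H.Adj v u then pairWeight A ρ θ v u ^ 2 else 0 : ℕ) : ℝ) := by
        rw [pairSum, Nat.cast_sum]
        refine Finset.sum_congr rfl fun v _ => ?_
        rw [← Nat.cast_mul, Finset.mul_sum]
        simp only [mul_ite, mul_zero]
    _ ≤ ∑ v, ((A v).length : ℝ) * (4 * K) :=
        Finset.sum_le_sum fun v _ => by gcongr; exact h1 v
    _ = 4 * K * numEntries A := by
        rw [← Finset.sum_mul, numEntries]
        push_cast
        ring

/-! ### Capped degrees -/

/-- The degree of the vertex named `v` if its square is at most `c`, and otherwise `0`. -/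
def cappedDegree (A : ErasedLists n) (c v : ℕ) : ℕ :=
  if degreeOf A v * degreeOf A v ≤ c then degreeOf A v else 0

/-- Every edge has a light end unless it lies inside the set of the few heavy vertices, so the
light vertices have at least `3/8` of all entries. -/
theorem Completes.le_sum_cappedDegree (h : Completes A H L) :
    3 / 8 * (numEntries A : ℝ) ≤
      ((∑ v : Fin n, cappedDegree A (4 * numEntries A) v : ℕ) : ℝ) := by
  classical
  set D := numEntries A with hD
  rcases Nat.eq_zero_or_pos D with hD0 | hDpos
  · rw [hD0, Nat.cast_zero, mul_zero]
    positivity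
  set S := Finset.univ.filter fun v => 4 * D < (A v).length * (A v).length with hS
  have h1 : D ≤ pairSum H (fun v _ => 2 * if v ∈ S then 0 else 1) + S.card ^ 2 := by
    rw [hD, h.numEntries_eq]
    refine pairSum_one_le S fun v u _ hvuS => ?_
    by_cases hv : v ∈ S <;> by_cases hu : u ∈ S
    · exact absurd ⟨hv, hu⟩ hvuS
    all_goals simp [hv, hu]
  have h2 : pairSum H (fun v _ => 2 * if v ∈ S then 0 else 1) =
      2 * ∑ v : Fin n, cappedDegree A (4 * D) v := by
    rw [pairSum_const_mul, pairSum]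
    congr 1
    refine Finset.sum_congr rfl fun v _ => ?_
    rw [cappedDegree, degreeOf_fin]
    by_cases hv : (A v).length * (A v).length ≤ 4 * D
    · have : v ∉ S := by simpa [hS] using hv
      simp only [this, hv, if_false, if_true]
      exact (h.length_eq v).symm
    · have : v ∈ S := by simpa [hS] using hv
      simp [this, hv]
  have h3 : (S.card : ℝ) ^ 2 * (4 * D) ≤ (D : ℝ) ^ 2 := by
    refine card_sq_mul_le S fun v hv => ?_
    have : 4 * D < (A v).length * (A v).length := by simpa [hS] using hv
    rw [sq]
    exact_mod_cast this.le
  have hD' : (0 : ℝ) < D := by exact_mod_cast hDpos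
  have h4 : (S.card : ℝ) ^ 2 ≤ D / 4 := by
    have : (S.card : ℝ) ^ 2 * (4 * D) ≤ D / 4 * (4 * D) := by linarith
    exact le_of_mul_le_mul_right this (by positivity)
  rw [h2] at h1
  have h1' : (D : ℝ) ≤ 2 * ((∑ v : Fin n, cappedDegree A (4 * D) v : ℕ) : ℝ) +
      (S.card : ℝ) ^ 2 := by
    exact_mod_cast h1
  linarith

theorem expect_cappedDegree (hn : 0 < n) (c : ℕ) :
    expect ((unif n).map (cappedDegree A c)) (fun x => (x : ℝ≥0∞)) =
      ENNReal.ofReal (((∑ v : Fin n, cappedDegree A c v : ℕ) : ℝ) / n) := by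
  rw [ofReal_natCast_div hn, expect_map, expect_unif_fin hn, Nat.cast_sum]

theorem expect_cappedDegree_sq_le (hn : 0 < n) (c : ℕ) :
    expect ((unif n).map (cappedDegree A c)) (fun x => (x : ℝ≥0∞) ^ 2) ≤
      ENNReal.ofReal (√c * ((∑ v : Fin n, cappedDegree A c v : ℕ) : ℝ) / n) := by
  rw [expect_map, expect_unif_fin hn]
  have h1 : ∑ v : Fin n, ((cappedDegree A c v : ℕ) : ℝ≥0∞) ^ 2 =
      ((∑ v : Fin n, cappedDegree A c v ^ 2 : ℕ) : ℝ≥0∞) := by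
    push_cast
    rfl
  rw [h1, ← ofReal_natCast_div hn]
  apply ENNReal.ofReal_le_ofReal
  gcongr
  push_cast
  rw [Finset.mul_sum]
  refine Finset.sum_le_sum fun v _ => ?_
  rw [sq]
  gcongr
  apply Real.le_sqrt_of_sq_le
  rw [cappedDegree]
  split_ifs with hv
  · rw [sq]
    exact_mod_cast hv
  · simp

theorem expect_degreeOf (hn : 0 < n) :
    expect ((unif n).map (degreeOf A)) (fun x => (x : ℝ≥0∞)) = ENNReal.ofReal (avgDegree A) := by
  rw [avgDegree, ofReal_natCast_div hn, expect_map, expect_unif_fin hn, numEntries, Nat.cast_sum]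
  simp only [degreeOf_fin]

end Moments

/-! ### The program -/

/-- One round of the computation of `⌈√n⌉` in cell `2`: increase it, and leave `n - M[2]²` in
cell `3`. -/
def sqrtBody : Program :=
  .seq (.arith .add 2 2 4) <| .seq (.arith .mul 3 2 2) <| .arith .sub 3 0 3

/-- One round of the first sampling loop: the degree of a random vertex is added to cell `10`. -/
def degreeBody : Program :=
  .seq (.rand 5 0) <| .seq (.degree 6 5) <| .seq (.arith .add 10 10 6) <| .arith .sub 3 3 4

/-- One round of the second sampling loop: `estimate A ρ θ v u`, with `ρ` in cell `12` and `θ` in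
cell `11`, is added to cell `13`, for a random vertex `v` (cell `5`) and a random entry `u`
(cell `7`) of its list. -/
def estimateBody : Program :=
  .seq (.rand 5 0) <| .seq (.degree 6 5) <| .seq (.neighbor 7 5) <| .seq (.degree 8 7) <|
  .seq (.arith .add 8 8 4) <| .seq (.arith .sub 8 8 6) <|
  .seq (.arith .sub 8 15 8) <| .seq (.arith .sub 8 15 8) <|
  .seq (.arith .sub 7 0 7) <| .seq (.arith .sub 7 4 7) <|
  .seq (.arith .mul 9 6 6) <| .seq (.arith .mul 9 9 12) <| .seq (.arith .sub 9 9 11) <|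
  .seq (.arith .sub 9 4 9) <| .seq (.arith .mul 9 9 7) <| .seq (.arith .mul 9 9 15) <|
  .seq (.arith .add 8 8 9) <| .seq (.arith .mul 8 8 6) <|
  .seq (.arith .add 13 13 8) <| .arith .sub 3 3 4

/-- What follows the first sampling loop: the threshold `θ` and the number of samples are computed,
the second sampling loop is run, and the output is put in place. -/
def secondPhase : Program :=
  .seq (.arith .mul 11 10 0) <| .seq (.arith .mul 11 11 1) <| .seq (.const 5 12) <|
  .seq (.arith .mul 11 11 5) <|
  .seq (.const 14 1152) <| .seq (.arith .mul 14 14 2) <| .seq (.arith .mul 14 14 1) <|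
  .seq (.arith .mul 14 14 1) <| .seq (.arith .mul 14 14 1) <| .seq (.arith .add 3 14 16) <|
  .seq (.while 3 estimateBody) <|
  .seq (.arith .add 0 13 16) <| .arith .add 1 14 16

/-- The program. With `k = ⌈√n⌉` and the inputs `n` and `E`, it sums the degrees of `576 k` random
vertices, to a number `S`, and then divides the sum of `1152 k E³` estimates with the parameters
`ρ = 576 k` and `θ = 12 S n E` by their number. Cells `4`, `15` and `16` hold the constants `1`,
`2` and `0`, and cell `3` holds the loop counter. -/
def averageDegreeProgram : Program :=
  .seq (.const 4 1) <| .seq (.const 15 2) <| .seq (.arith .add 3 0 16) <|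
  .seq (.while 3 sqrtBody) <|
  .seq (.const 12 576) <| .seq (.arith .mul 12 12 2) <| .seq (.arith .add 3 12 16) <|
  .seq (.while 3 degreeBody) secondPhase

/-! ### What the loops compute -/

theorem write_mem (s : State) (d x i : ℕ) :
    (s.write d x).mem i = if i = d then x else s.mem i := by
  simp [State.write, Function.update_apply]

theorem tick_mem (s : State) : s.tick.mem = s.mem := rfl

theorem ask_mem (s : State) : s.ask.mem = s.mem := rfl

theorem write_steps (s : State) (d x : ℕ) : (s.write d x).steps = s.steps := rfl

theorem tick_steps (s : State) : s.tick.steps = s.steps + 1 := rfl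

theorem ask_steps (s : State) : s.ask.steps = s.steps := rfl

theorem write_queries (s : State) (d x : ℕ) : (s.write d x).queries = s.queries := rfl

theorem tick_queries (s : State) : s.tick.queries = s.queries := rfl

theorem ask_queries (s : State) : s.ask.queries = s.queries + 1 := rfl

theorem write_peak (s : State) (d x : ℕ) : (s.write d x).peak = max s.peak x := rfl

theorem tick_peak (s : State) : s.tick.peak = s.peak := rfl

theorem ask_peak (s : State) : s.ask.peak = s.peak := rfl

/-- The number of vertices that the program samples in its first phase. -/
def firstRounds (k : ℕ) : ℕ := 576 * k

/-- The number of entries that the program samples in its second phase. -/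
def secondRounds (k E : ℕ) : ℕ := 1152 * k * E * E * E

/-- A bound on all numbers that the program stores. -/
def wordBound (n E : ℕ) : ℕ := 6912 * n ^ 3 * E ^ 3

/-- The cells that no loop changes, and the bound on all numbers stored so far. -/
structure Frame (n E : ℕ) (s : State) : Prop where
  cell0 : s.mem 0 = n
  cell1 : s.mem 1 = E
  cell4 : s.mem 4 = 1
  cell15 : s.mem 15 = 2
  cell16 : s.mem 16 = 0
  peak_le : s.peak ≤ wordBound n E

/-- The invariant of the computation of `k = ⌈√n⌉`, with `i` rounds to go. At most `t` steps have
been made at the end of the last round. -/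
structure SqrtInv (n E k t i : ℕ) (s : State) : Prop extends Frame n E s where
  cell2 : s.mem 2 + i = k
  cell3 : s.mem 3 = n - s.mem 2 * s.mem 2
  cell10 : s.mem 10 = 0
  cell13 : s.mem 13 = 0
  queries_eq : s.queries = 0
  steps_le : s.steps + 4 * i ≤ t

/-- The invariant of the first sampling loop, with `i` rounds to go and the sum `S` so far. -/
structure DegreeInv (n E k t i S : ℕ) (s : State) : Prop extends Frame n E s where
  cell2 : s.mem 2 = k
  cell3 : s.mem 3 = i
  cell10 : s.mem 10 = S
  cell12 : s.mem 12 = firstRounds k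
  cell13 : s.mem 13 = 0
  sum_le : S + i * n ≤ firstRounds k * n
  queries_eq : s.queries + i = firstRounds k
  steps_le : s.steps + 5 * i ≤ t

/-- The invariant of the second sampling loop, with `i` rounds to go and the sum `S` so far. -/
structure EstimateInv (n E k θ t i S : ℕ) (s : State) : Prop extends Frame n E s where
  cell3 : s.mem 3 = i
  cell11 : s.mem 11 = θ
  cell12 : s.mem 12 = firstRounds k
  cell13 : s.mem 13 = S
  cell14 : s.mem 14 = secondRounds k E
  sum_le : S + i * (4 * n) ≤ secondRounds k E * (4 * n)
  queries_eq : s.queries + 3 * i = firstRounds k + 3 * secondRounds k E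
  steps_le : s.steps + 21 * i ≤ t

/-- What holds when the program has stopped with the numerator `S`. -/
structure FinalState (n E k S : ℕ) (s : State) : Prop where
  cell0 : s.mem 0 = S
  cell1 : s.mem 1 = secondRounds k E
  queries_eq : s.queries = firstRounds k + 3 * secondRounds k E
  steps_le : s.steps ≤ 4 * k + 5 * firstRounds k + 21 * secondRounds k E + 21
  peak_le : s.peak ≤ wordBound n E

section Bounds

variable {n E k : ℕ}

theorem mul_le_wordBound (hn : 0 < n) (hE : 0 < E) {c i j : ℕ} (hc : c ≤ 6912) (hi : i ≤ 3)
    (hj : j ≤ 3) : c * n ^ i * E ^ j ≤ wordBound n E := by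
  rw [wordBound]
  gcongr

theorem firstRounds_mul_le (hn : 0 < n) (hE : 0 < E) (hk : k ≤ n) {x : ℕ} (hx : x ≤ n * n) :
    x * firstRounds k ≤ wordBound n E := by
  refine le_trans ?_ (mul_le_wordBound (c := 576) (i := 3) (j := 0) hn hE (by norm_num) le_rfl
    (by norm_num))
  rw [firstRounds]
  calc x * (576 * k) ≤ (n * n) * (576 * n) := by gcongr
    _ = 576 * n ^ 3 * E ^ 0 := by ring

theorem secondRounds_mul_le (hn : 0 < n) (hE : 0 < E) (hk : k ≤ n) :
    secondRounds k E * (4 * n) ≤ wordBound n E := by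
  refine le_trans ?_ (mul_le_wordBound (c := 4608) (i := 2) (j := 3) hn hE (by norm_num)
    (by norm_num) le_rfl)
  rw [secondRounds]
  calc 1152 * k * E * E * E * (4 * n) ≤ 1152 * n * E * E * E * (4 * n) := by gcongr
    _ = 4608 * n ^ 2 * E ^ 3 := by ring

theorem le_wordBound (hn : 0 < n) (hE : 0 < E) : 2000 * n ≤ wordBound n E := by
  simpa using mul_le_wordBound (c := 2000) (i := 1) (j := 0) hn hE (by norm_num) (by norm_num)
    (by norm_num)

theorem sq_le_wordBound (hn : 0 < n) (hE : 0 < E) : n * n ≤ wordBound n E := by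
  simpa [sq] using mul_le_wordBound (c := 1) (i := 2) (j := 0) hn hE (by norm_num) (by norm_num)
    (by norm_num)

end Bounds

section Loops

variable {n : ℕ} {A : ErasedLists n} {E k t fuel : ℕ}

theorem entryOf_le (v i : ℕ) : entryOf A v i ≤ n := by
  rw [entryOf]
  split_ifs with hv
  · split
    · exact Fin.is_le'
    · exact le_rfl
  · exact le_rfl

theorem le_of_mem_support_randomNeighbor {v u : ℕ} (hu : u ∈ (randomNeighbor A v).support) :
    u ≤ n := by
  rw [randomNeighbor, PMF.mem_support_map_iff] at hu
  obtain ⟨i, -, rfl⟩ := hu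
  exact entryOf_le v i

theorem degreeOf_le (hA : ∀ v, (A v).length ≤ n) (v : ℕ) : degreeOf A v ≤ n := by
  rw [degreeOf]
  split_ifs with hv
  · exact hA _
  · exact Nat.zero_le _

theorem sqrtBody_simulates (hn : 0 < n) (hE : 0 < E) (hk : n ≤ k * k) (hk' : ∀ j < k, j * j < n)
    {s : State} (hs : SqrtInv n E k t k s) (hfuel : k < fuel) :
    Simulates (Program.run A fuel (.while 3 sqrtBody) s) (PMF.pure ())
      fun _ s' => SqrtInv n E k (t + 1) 0 s' := by
  have hpure : ∀ j, iterStep (fun _ : Unit => PMF.pure ()) j () = PMF.pure () := by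
    intro j
    induction j with
    | zero => rfl
    | succ j ih => rw [iterStep, PMF.pure_bind, ih]
  rw [run_while, ← hpure k]
  refine Simulates.iterWhile (fun i _ s => SqrtInv n E k t i s) ?_ ?_ hs hfuel
  · intro _ s h
    have h2 := h.cell2
    refine ⟨?_, ⟨⟨h.cell0, h.cell1, h.cell4, h.cell15, h.cell16, h.peak_le⟩, h.cell2, h.cell3,
      h.cell10, h.cell13, h.queries_eq, ?_⟩⟩
    · rw [h.cell3, show s.mem 2 = k by omega]
      omega
    · simpa [tick_steps] using h.steps_le
  · intro i _ s h
    have h2 := h.cell2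
    have hlt := hk' (s.mem 2) (by omega)
    refine ⟨by rw [h.cell3]; omega, ?_⟩
    rw [sqrtBody, run_seq_arith, run_seq_arith, run_arith]
    have hsq : (s.mem 2 + 1) * (s.mem 2 + 1) ≤ wordBound n E := by
      have h3 : s.mem 2 * s.mem 2 + 1 ≤ n := hlt
      have h4 : s.mem 2 ≤ s.mem 2 * s.mem 2 := Nat.le_mul_self _
      have := le_wordBound hn hE
      nlinarith
    have hw := le_wordBound hn hE
    have hle : s.mem 2 + 1 ≤ (s.mem 2 + 1) * (s.mem 2 + 1) := Nat.le_mul_self _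
    have hsub : n - (s.mem 2 + 1) * (s.mem 2 + 1) ≤ wordBound n E := by omega
    refine Simulates.pure ⟨⟨?_, ?_, ?_, ?_, ?_, ?_⟩, ?_, ?_, ?_, ?_, ?_, ?_⟩ <;>
      simp [write_mem, tick_mem, write_steps, tick_steps, write_queries,
        tick_queries, write_peak, tick_peak, ArithOp.eval, h.cell0, h.cell1, h.cell4, h.cell15,
        h.cell16, h.cell10, h.cell13, h.queries_eq, h.peak_le]
    · omega
    · omega
    · have := h.steps_le
      omega

theorem degreeBody_simulates (hn : 0 < n) (hE : 0 < E) (hk : k ≤ n)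
    (hA : ∀ v, (A v).length ≤ n) {s : State} (hs : DegreeInv n E k t (firstRounds k) 0 s)
    (hfuel : firstRounds k < fuel) :
    Simulates (Program.run A fuel (.while 3 degreeBody) s)
      (sumLaw ((unif n).map (degreeOf A)) (firstRounds k) 0)
      fun S s' => DegreeInv n E k (t + 1) 0 S s' := by
  rw [run_while]
  refine Simulates.iterWhile (fun i S s => DegreeInv n E k t i S s) ?_ ?_ hs hfuel
  · intro S s h
    refine ⟨h.cell3, ⟨⟨h.cell0, h.cell1, h.cell4, h.cell15, h.cell16, h.peak_le⟩, h.cell2,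
      h.cell3, h.cell10, h.cell12, h.cell13, h.sum_le, h.queries_eq, ?_⟩⟩
    · simpa [tick_steps] using h.steps_le
  · intro i S s h
    refine ⟨by rw [h.cell3]; omega, ?_⟩
    rw [degreeBody, run_seq_rand, PMF.map_comp, ← PMF.bind_pure_comp, tick_mem, h.cell0]
    refine Simulates.draw _ fun v hv => ?_
    have hv' := lt_of_mem_support_unif hn hv
    have hd := degreeOf_le hA v
    have hw := le_wordBound hn hE
    rw [run_seq_degree, run_seq_arith, run_arith]
    have hsum : S + degreeOf A v + i * n ≤ firstRounds k * n := by
      have := h.sum_le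
      rw [Nat.succ_mul] at this
      omega
    have hS : S + degreeOf A v ≤ wordBound n E := by
      have h1 := firstRounds_mul_le hn hE hk (x := n) (Nat.le_mul_self n)
      rw [mul_comm] at h1
      omega
    have hi : i ≤ wordBound n E := by
      have h1 := h.queries_eq
      rw [firstRounds] at h1
      omega
    refine Simulates.pure ⟨⟨?_, ?_, ?_, ?_, ?_, ?_⟩, ?_, ?_, ?_, ?_, ?_, ?_, ?_, ?_⟩ <;>
      simp [write_mem, tick_mem, ask_mem, write_steps, tick_steps, ask_steps, write_queries,
        tick_queries, ask_queries, write_peak, tick_peak, ask_peak, ArithOp.eval, h.cell0,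
        h.cell1, h.cell2, h.cell3, h.cell4, h.cell15, h.cell16, h.cell10, h.cell12, h.cell13,
        h.peak_le]
    · omega
    · exact hsum
    · have := h.queries_eq
      omega
    · have := h.steps_le
      omega

theorem map_add_estimateLaw (ρ θ S : ℕ) : (estimateLaw A ρ θ).map (S + ·) =
    (unif n).bind fun v => (randomNeighbor A v).bind fun u =>
      PMF.pure (S + estimate A ρ θ v u) := by
  rw [estimateLaw, PMF.map_bind]
  congr 1
  ext1 v
  rw [PMF.map_comp, ← PMF.bind_pure_comp]
  rfl

theorem estimateBody_simulates (hn : 0 < n) (hE : 0 < E) (hk : k ≤ n)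
    (hA : ∀ v, (A v).length ≤ n) {θ : ℕ} {s : State}
    (hs : EstimateInv n E k θ t (secondRounds k E) 0 s) (hfuel : secondRounds k E < fuel) :
    Simulates (Program.run A fuel (.while 3 estimateBody) s)
      (sumLaw (estimateLaw A (firstRounds k) θ) (secondRounds k E) 0)
      fun S s' => EstimateInv n E k θ (t + 1) 0 S s' := by
  rw [run_while]
  refine Simulates.iterWhile (fun i S s => EstimateInv n E k θ t i S s) ?_ ?_ hs hfuel
  · intro S s h
    refine ⟨h.cell3, ⟨⟨h.cell0, h.cell1, h.cell4, h.cell15, h.cell16, h.peak_le⟩, h.cell3,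
      h.cell11, h.cell12, h.cell13, h.cell14, h.sum_le, h.queries_eq, ?_⟩⟩
    · simpa [tick_steps] using h.steps_le
  · intro i S s h
    refine ⟨by rw [h.cell3]; omega, ?_⟩
    rw [estimateBody, run_seq_rand, map_add_estimateLaw, tick_mem, h.cell0]
    refine Simulates.draw _ fun v hv => ?_
    have hv' := lt_of_mem_support_unif hn hv
    rw [run_seq_degree, run_seq_neighbor]
    simp only [write_mem, tick_mem, ask_mem, if_true]
    norm_num only [if_true, if_false]
    refine Simulates.draw _ fun u hu => ?_
    have hu' := le_of_mem_support_randomNeighbor hu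
    have hd := degreeOf_le hA v
    have hd' := degreeOf_le hA u
    have hw := le_wordBound hn hE
    have hdd : degreeOf A v * degreeOf A v ≤ n * n := Nat.mul_le_mul hd hd
    have hddw := hdd.trans (sq_le_wordBound hn hE)
    have hddr := firstRounds_mul_le hn hE hk hdd
    have hlight : (1 - (degreeOf A v * degreeOf A v * firstRounds k - θ)) * (1 - (n - u)) ≤ 1 :=
      Nat.mul_le_mul (Nat.sub_le 1 _) (Nat.sub_le 1 _)
    have hweight : entryWeight A (firstRounds k) θ v u ≤ 4 := by
      rw [entryWeight]
      omega
    have hest : estimate A (firstRounds k) θ v u ≤ 4 * n := Nat.mul_le_mul hweight hd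
    have hsum : S + estimate A (firstRounds k) θ v u + i * (4 * n) ≤
        secondRounds k E * (4 * n) := by
      have := h.sum_le
      rw [Nat.succ_mul] at this
      omega
    have hS : S + estimate A (firstRounds k) θ v u ≤ wordBound n E := by
      have h1 := secondRounds_mul_le hn hE hk
      omega
    have hi : i ≤ wordBound n E := by
      have h1 := h.sum_le
      have h2 := secondRounds_mul_le hn hE hk
      nlinarith
    have hw_eq : (2 - (2 - (degreeOf A u + 1 - degreeOf A v))) +
      (1 - (degreeOf A v * degreeOf A v * firstRounds k - θ)) * (1 - (n - u)) * 2 =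
      entryWeight A (firstRounds k) θ v u := rfl
    have he_eq : entryWeight A (firstRounds k) θ v u * degreeOf A v =
      estimate A (firstRounds k) θ v u := rfl
    simp only [run_seq_arith, run_seq_degree, run_arith, write_mem, tick_mem, ask_mem,
      ArithOp.eval, h.cell0, h.cell3, h.cell4, h.cell11, h.cell12, h.cell13, h.cell15,
      Nat.reduceEqDiff, if_true, if_false,
      Nat.add_sub_cancel, hw_eq, he_eq]
    refine Simulates.pure ⟨⟨?_, ?_, ?_, ?_, ?_, ?_⟩, ?_, ?_, ?_, ?_, ?_, ?_, ?_, ?_⟩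
    · simp [write_mem, tick_mem, ask_mem, h.cell0]
    · simp [write_mem, tick_mem, ask_mem, h.cell1]
    · simp [write_mem, tick_mem, ask_mem, h.cell4]
    · simp [write_mem, tick_mem, ask_mem, h.cell15]
    · simp [write_mem, tick_mem, ask_mem, h.cell16]
    · have := h.peak_le
      simp only [write_peak, tick_peak, ask_peak, max_le_iff]
      refine ⟨⟨⟨⟨⟨⟨⟨⟨⟨⟨⟨⟨⟨⟨⟨⟨⟨⟨⟨⟨?_, ?_⟩, ?_⟩, ?_⟩, ?_⟩, ?_⟩, ?_⟩, ?_⟩, ?_⟩, ?_⟩, ?_⟩, ?_⟩, ?_⟩, ?_⟩, ?_⟩,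
        ?_⟩, ?_⟩, ?_⟩, ?_⟩, ?_⟩, ?_⟩ <;> omega
    · simp [write_mem]
    · simp [write_mem, tick_mem, ask_mem, h.cell11]
    · simp [write_mem, tick_mem, ask_mem, h.cell12]
    · simp [write_mem, tick_mem]
    · simp [write_mem, tick_mem, ask_mem, h.cell14]
    · exact hsum
    · have := h.queries_eq
      simp only [write_queries, tick_queries, ask_queries]
      omega
    · have := h.steps_le
      simp only [write_steps, tick_steps, ask_steps]
      omega

/-- The second phase adds up the estimates with the threshold given by the sum `S` of degrees. -/
theorem secondPhase_simulates (hn : 0 < n) (hE : 0 < E) (hkn : k ≤ n)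
    (hA : ∀ v, (A v).length ≤ n) (hf : secondRounds k E < fuel) {S : ℕ} {s : State}
    (h : DegreeInv n E k (4 * k + 5 * firstRounds k + 8) 0 S s) :
    Simulates (Program.run A fuel secondPhase s)
      (sumLaw (estimateLaw A (firstRounds k) (S * n * E * 12)) (secondRounds k E) 0)
      (FinalState n E k) := by
  have hw := le_wordBound hn hE
  have hp := h.peak_le
  have hs := h.steps_le
  have hr2 : 1152 * k * E * E * E = secondRounds k E := rfl
  have hS' : S ≤ 576 * n * n := by
    have hS := h.sum_le
    rw [zero_mul, add_zero, firstRounds] at hS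
    exact hS.trans (by gcongr)
  have hθ : S * n * E * 12 ≤ wordBound n E := by
    refine le_trans ?_ (mul_le_wordBound (c := 6912) (i := 3) (j := 1) hn hE le_rfl le_rfl
      (by norm_num))
    calc S * n * E * 12 ≤ 576 * n * n * n * E * 12 := by gcongr
      _ = _ := by ring
  have hr2w : secondRounds k E ≤ wordBound n E :=
    (Nat.le_mul_of_pos_right _ (by omega)).trans (secondRounds_mul_le hn hE hkn)
  have hl1 : S * n ≤ S * n * E := Nat.le_mul_of_pos_right _ hE
  have hl2 : 1152 * k ≤ 1152 * k * E := Nat.le_mul_of_pos_right _ hE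
  have hl3 : 1152 * k * E ≤ 1152 * k * E * E := Nat.le_mul_of_pos_right _ hE
  have hl4 : 1152 * k * E * E ≤ secondRounds k E := Nat.le_mul_of_pos_right _ hE
  rw [secondPhase]
  simp only [run_seq_const, run_seq_arith, write_mem, tick_mem, ArithOp.eval,
    Nat.reduceEqDiff, if_true, if_false, h.cell0, h.cell1, h.cell2, h.cell10, h.cell16, hr2,
    Nat.add_zero, OfNat.one_ne_ofNat]
  rw [← PMF.bind_pure (sumLaw (estimateLaw _ _ _) _ _)]
  refine simulates_seq A fuel (estimateBody_simulates (θ := S * n * E * 12)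
    (t := 4 * k + 5 * firstRounds k + 18 + 21 * secondRounds k E) hn hE hkn hA ?_ hf) ?_
  · refine ⟨⟨?_, ?_, ?_, ?_, ?_, ?_⟩, ?_, ?_, ?_, ?_, ?_, ?_, ?_, ?_⟩
    · simp [write_mem, tick_mem, h.cell0]
    · simp [write_mem, tick_mem, h.cell1]
    · simp [write_mem, tick_mem, h.cell4]
    · simp [write_mem, tick_mem, h.cell15]
    · simp [write_mem, tick_mem, h.cell16]
    · simp only [write_peak, tick_peak, max_le_iff]
      refine ⟨⟨⟨⟨⟨⟨⟨⟨⟨⟨?_, ?_⟩, ?_⟩, ?_⟩, ?_⟩, ?_⟩, ?_⟩, ?_⟩, ?_⟩, ?_⟩, ?_⟩ <;> omega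
    · simp [write_mem]
    · simp [write_mem, tick_mem]
    · simp [write_mem, tick_mem, h.cell12]
    · simp [write_mem, tick_mem, h.cell13]
    · simp [write_mem, tick_mem]
    · omega
    · have := h.queries_eq
      simp only [write_queries, tick_queries]
      omega
    · simp only [write_steps, tick_steps]
      omega
  intro X s h
  have hq := h.queries_eq
  have hp := h.peak_le
  have hs := h.steps_le
  have hX := h.sum_le
  have hXw := secondRounds_mul_le hn hE hkn
  rw [run_seq_arith, run_arith]
  refine Simulates.pure ⟨?_, ?_, ?_, ?_, ?_⟩ <;>
    simp [write_mem, tick_mem, write_steps, tick_steps, write_queries, tick_queries, write_peak,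
      tick_peak, ArithOp.eval, h.cell13, h.cell14, h.cell16, hp]
  · omega
  · omega
  · omega

/-- The run of the program: first the sum `S` of the degrees of random vertices, then the sum of
the estimates with the threshold given by `S`. -/
theorem averageDegreeProgram_simulates (hn : 0 < n) (hE : 0 < E) (hk : n ≤ k * k)
    (hk' : ∀ j < k, j * j < n) (hkn : k ≤ n) (hA : ∀ v, (A v).length ≤ n)
    (hf : k < fuel) (hf1 : firstRounds k < fuel) (hf2 : secondRounds k E < fuel) :
    Simulates (Program.run A fuel averageDegreeProgram (State.init n E))
      ((sumLaw ((unif n).map (degreeOf A)) (firstRounds k) 0).bind fun S =>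
        sumLaw (estimateLaw A (firstRounds k) (S * n * E * 12)) (secondRounds k E) 0)
      (FinalState n E k) := by
  have hw := le_wordBound hn hE
  have hEw : E ≤ wordBound n E := by
    simpa using mul_le_wordBound (c := 1) (i := 0) (j := 1) hn hE (by norm_num) (by norm_num)
      (by norm_num)
  rw [averageDegreeProgram, run_seq_const, run_seq_const, run_seq_arith]
  simp only [write_mem, tick_mem, ArithOp.eval, State.init, Nat.reduceEqDiff, if_true, if_false,
    OfNat.zero_ne_ofNat, OfNat.ofNat_ne_zero, OfNat.ofNat_ne_one, Nat.add_zero]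
  rw [← PMF.pure_bind () fun _ => (sumLaw ((unif n).map (degreeOf A)) (firstRounds k) 0).bind
    fun S => sumLaw (estimateLaw A (firstRounds k) (S * n * E * 12)) (secondRounds k E) 0]
  refine simulates_seq A fuel (sqrtBody_simulates (t := 4 * k + 3) hn hE hk hk' ?_ hf) ?_
  · refine ⟨⟨?_, ?_, ?_, ?_, ?_, ?_⟩, ?_, ?_, ?_, ?_, ?_, ?_⟩ <;>
      simp [write_mem, tick_mem, write_steps, tick_steps, write_queries,
        tick_queries, write_peak, tick_peak]
    · omega
    · omega
  intro _ s h
  have hp := h.peak_le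
  have hs := h.steps_le
  have hr1 : 576 * k = firstRounds k := rfl
  have hr1w : firstRounds k ≤ wordBound n E := by
    rw [firstRounds]
    omega
  have hc2 : s.mem 2 = k := h.cell2
  simp only [run_seq_const, run_seq_arith, write_mem, tick_mem, ArithOp.eval,
    Nat.reduceEqDiff, if_true, if_false, hc2, h.cell16, hr1, Nat.add_zero]
  refine simulates_seq A fuel (degreeBody_simulates
    (t := 4 * k + 7 + 5 * firstRounds k) hn hE hkn hA ?_ hf1) ?_
  · refine ⟨⟨?_, ?_, ?_, ?_, ?_, ?_⟩, ?_, ?_, ?_, ?_, ?_, ?_, ?_, ?_⟩ <;>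
      simp [write_mem, tick_mem, write_steps, tick_steps, write_queries,
        tick_queries, write_peak, tick_peak, h.cell0, h.cell1, hc2, h.cell4, h.cell10, h.cell13,
        h.cell15, h.cell16, h.queries_eq, hp]
    · omega
    · omega
  · intro S s h
    exact secondPhase_simulates hn hE hkn hA hf2 { h with steps_le := by have := h.steps_le; omega }

end Loops

/-! ### Correctness with high probability -/

section Analysis

variable {n : ℕ} {A : ErasedLists n} {H : SimpleGraph (Fin n)} {L : Fin n → List (Fin n)}
  {E k : ℕ}

/-- With `D = 2m`, the ratio `√D / (D / n) = n / √D`, which governs the relative variance of both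
kinds of samples, is at most `√n ≤ k`, since `D ≥ n`. -/
theorem sqrt_numEntries_le (hn : 0 < n) (hd : 1 ≤ avgDegree A) (hk : n ≤ k * k) :
    √(numEntries A) ≤ k * avgDegree A := by
  have hn' : (0 : ℝ) < n := by exact_mod_cast hn
  have hk' : (n : ℝ) ≤ (k : ℝ) ^ 2 := by
    rw [sq]
    exact_mod_cast hk
  have hD : (numEntries A : ℝ) = avgDegree A * n := by
    rw [avgDegree]
    field_simp
  rw [Real.sqrt_le_iff]
  refine ⟨by positivity, ?_⟩
  rw [hD, mul_pow]
  have : avgDegree A * n ≤ avgDegree A ^ 2 * (k : ℝ) ^ 2 := by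
    gcongr
    nlinarith
  linarith

/-- The sum of the degrees of random vertices is unlikely to be too small: this already holds for
the degrees that are capped at `2 √(2m)`. -/
theorem Completes.prob_degreeSum_lt_le (h : Completes A H L) (hn : 0 < n)
    (hd : 1 ≤ avgDegree A) (hk : n ≤ k * k) :
    prob (sumLaw ((unif n).map (degreeOf A)) (firstRounds k) 0)
      {S | (S : ℝ) < firstRounds k * avgDegree A / 4} ≤ ENNReal.ofReal (1 / 12) := by
  have hn' : (0 : ℝ) < n := by exact_mod_cast hn
  have hkpos : 0 < k := Nat.pos_of_ne_zero (by rintro rfl; omega)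
  have hk' : (0 : ℝ) < k := by exact_mod_cast hkpos
  set D := numEntries A with hD
  set μ : ℝ := ((∑ v : Fin n, cappedDegree A (4 * D) v : ℕ) : ℝ) / n with hμ
  have hμd : 3 / 8 * avgDegree A ≤ μ := by
    rw [hμ, avgDegree, ← mul_div_assoc]
    gcongr
    exact h.le_sum_cappedDegree
  have hμ0 : 0 < μ := by linarith
  have hr : (firstRounds k : ℝ) = 576 * k := by simp [firstRounds]
  refine (prob_sumLaw_map_lt_mono (unif n) (g := cappedDegree A (4 * D)) ?_ _ _ le_rfl).trans ?_
  · intro v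
    rw [cappedDegree]
    split_ifs <;> omega
  have hsq : √((4 * D : ℕ) : ℝ) = 2 * √D := by
    push_cast
    rw [Real.sqrt_mul (by norm_num), show (4 : ℝ) = 2 ^ 2 by norm_num,
      Real.sqrt_sq (by norm_num)]
  have hcheb := prob_sumLaw_deviation_le ((unif n).map (cappedDegree A (4 * D)))
    (t := firstRounds k * μ / 3) (δ := 1 / 12) hμ0.le (by rw [hr]; positivity)
    (expect_cappedDegree hn _) (expect_cappedDegree_sq_le hn _) (firstRounds k) ?_
  · refine (prob_mono _ fun S hS => ?_).trans hcheb
    have hS : (S : ℝ) < firstRounds k * avgDegree A / 4 := hS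
    have h1 : (firstRounds k : ℝ) * (3 / 8 * avgDegree A) ≤ firstRounds k * μ := by gcongr
    show firstRounds k * μ / 3 ≤ |(S : ℝ) - firstRounds k * μ|
    rw [abs_sub_comm]
    refine le_trans ?_ (le_abs_self _)
    linarith
  · rw [mul_div_assoc, ← hμ, hsq, hr]
    have h1 := sqrt_numEntries_le hn hd hk
    have h2 : 8 * √D ≤ 576 * k * μ / 27 := by nlinarith
    calc 576 * (k : ℝ) * (2 * √D * μ) = 8 * √D * (144 * (k * μ)) := by ring
      _ ≤ 576 * k * μ / 27 * (144 * (k * μ)) := by gcongr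
      _ = 1 / 12 * (576 * k * μ / 3) ^ 2 := by ring

theorem prob_degreeSum_ge_le (hn : 0 < n) (hd : 1 ≤ avgDegree A) (hk : n ≤ k * k) :
    prob (sumLaw ((unif n).map (degreeOf A)) (firstRounds k) 0)
      {S | 12 * (firstRounds k * avgDegree A) ≤ (S : ℝ)} ≤ ENNReal.ofReal (1 / 12) := by
  have hkpos : 0 < k := Nat.pos_of_ne_zero (by rintro rfl; omega)
  have hr : (0 : ℝ) < firstRounds k := by
    rw [firstRounds]
    positivity
  exact prob_sumLaw_ge_le _ (by positivity) (expect_degreeOf hn) _ (by linarith)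

/-- The sums of degrees for which the threshold of the second phase is of the right size. -/
def goodSums (A : ErasedLists n) (k : ℕ) : Set ℕ :=
  {S | firstRounds k * avgDegree A / 4 ≤ (S : ℝ) ∧ (S : ℝ) < 12 * (firstRounds k * avgDegree A)}

theorem Completes.prob_not_goodSums_le (h : Completes A H L) (hn : 0 < n)
    (hd : 1 ≤ avgDegree A) (hk : n ≤ k * k) :
    prob (sumLaw ((unif n).map (degreeOf A)) (firstRounds k) 0) (goodSums A k)ᶜ ≤
      ENNReal.ofReal (1 / 6) := by
  have hset : (goodSums A k)ᶜ ⊆ {S | (S : ℝ) < firstRounds k * avgDegree A / 4} ∪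
      {S | 12 * (firstRounds k * avgDegree A) ≤ (S : ℝ)} := by
    intro S hS
    by_contra hc
    simp only [Set.mem_union, Set.mem_ofPred_eq, not_or, not_lt, not_le] at hc
    exact hS hc
  refine (prob_mono _ hset).trans ((prob_union_le _ _ _).trans ?_)
  rw [show (1 / 6 : ℝ) = 1 / 12 + 1 / 12 by norm_num,
    ENNReal.ofReal_add (by norm_num) (by norm_num)]
  exact add_le_add (h.prob_degreeSum_lt_le hn hd hk) (prob_degreeSum_ge_le hn hd hk)

/-- The numerators for which the output is as desired, with the precision `1 / E`. -/
def goodNumerators (A : ErasedLists n) (k E : ℕ) (α : ℝ) : Set ℕ :=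
  {X | (1 - 1 / (E : ℝ)) * avgDegree A < (X : ℝ) / secondRounds k E ∧
    (X : ℝ) / secondRounds k E < (1 + 2 * min α (1 / 2) + 1 / (E : ℝ)) * avgDegree A}

theorem Completes.prob_not_goodNumerators_le (h : Completes A H L) {α : ℝ}
    (hα : (numErased A : ℝ) ≤ α * numEntries A) (hn : 0 < n) (hE : 0 < E)
    (hd : 1 ≤ avgDegree A) (hk : n ≤ k * k) {S : ℕ} (hS : S ∈ goodSums A k) :
    prob (sumLaw (estimateLaw A (firstRounds k) (S * n * E * 12)) (secondRounds k E) 0)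
      (goodNumerators A k E α)ᶜ ≤ ENNReal.ofReal (1 / 6) := by
  obtain ⟨hS1, hS2⟩ := hS
  have hn' : (0 : ℝ) < n := by exact_mod_cast hn
  have hE' : (1 : ℝ) ≤ E := by exact_mod_cast hE
  have hE0 : (0 : ℝ) < E := by linarith
  have hkpos : 0 < k := Nat.pos_of_ne_zero (by rintro rfl; omega)
  have hk' : (0 : ℝ) < k := by exact_mod_cast hkpos
  set ρ := firstRounds k with hρ
  set r := secondRounds k E with hr
  set θ := S * n * E * 12 with hθ
  set d := avgDegree A with hdd
  set D := numEntries A with hD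
  have hDd : (D : ℝ) = d * n := by
    rw [hdd, avgDegree]
    field_simp
    rfl
  have hD0 : (0 : ℝ) < D := by rw [hDd]; positivity
  have hρ0 : (0 : ℝ) < ρ := by
    rw [hρ, firstRounds]
    positivity
  have hr_eq : (r : ℝ) = 1152 * k * E ^ 3 := by
    rw [hr, secondRounds]
    push_cast
    ring
  have hr0 : (0 : ℝ) < r := by rw [hr_eq]; positivity
  have hθ_eq : (θ : ℝ) = S * n * E * 12 := by
    rw [hθ]
    push_cast
    rfl
  -- the threshold `θ / ρ` for the squares of degrees lies between `3 D E` and `144 D E`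
  have hθ1 : 3 * D * E * ρ ≤ (θ : ℝ) := by
    rw [hθ_eq, hDd]
    calc 3 * (d * n) * E * ρ = ρ * d / 4 * (n * E * 12) := by ring
      _ ≤ S * (n * E * 12) := by gcongr
      _ = _ := by ring
  have hθ2 : (θ : ℝ) ≤ 144 * D * E * ρ := by
    rw [hθ_eq, hDd]
    calc (S : ℝ) * n * E * 12 = S * (n * E * 12) := by ring
      _ ≤ 12 * (ρ * d) * (n * E * 12) := by gcongr
      _ = _ := by ring
  set K : ℝ := 12 * √(D * E) with hK
  have hheavy : ∀ x : ℕ, θ < x * x * ρ → 3 * D * E ≤ (x : ℝ) ^ 2 := by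
    intro x hx
    have hx' : (θ : ℝ) ≤ x * x * ρ := by exact_mod_cast hx.le
    have := hθ1.trans hx'
    rw [sq]
    exact le_of_mul_le_mul_right this hρ0
  have hlight : ∀ x : ℕ, x * x * ρ ≤ θ → (x : ℝ) ≤ K := by
    intro x hx
    have hx' : (x : ℝ) * x * ρ ≤ θ := by exact_mod_cast hx
    have h1 := le_of_mul_le_mul_right (hx'.trans hθ2) hρ0
    refine (pow_le_pow_iff_left₀ (by positivity) (by positivity) two_ne_zero).1 ?_
    rw [hK, mul_pow, Real.sq_sqrt (by positivity), sq]
    linarith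
  have hK' : √D ≤ K := by
    have h1 : √D ≤ √(D * E) := Real.sqrt_le_sqrt (le_mul_of_one_le_right hD0.le hE')
    have h2 : 0 ≤ √(D * E) := Real.sqrt_nonneg _
    linarith
  set F : ℝ := ((pairSum H (pairWeight A ρ θ) : ℕ) : ℝ) with hF
  have hF1 : d * (1 - 1 / (3 * E)) ≤ F / n := by
    rw [le_div_iff₀ hn']
    refine le_trans (le_of_eq ?_) (h.le_pairSum_pairWeight hheavy (by positivity))
    rw [hDd]
    field_simp
  have hF2 : F / n ≤ (1 + 2 * min α (1 / 2)) * d := by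
    rw [div_le_iff₀ hn', mul_assoc, ← hDd]
    exact h.pairSum_pairWeight_le hα ρ θ
  have hM : expect (estimateLaw A ρ θ) (fun x => (x : ℝ≥0∞) ^ 2) ≤
      ENNReal.ofReal (4 * K * d) := by
    rw [h.expect_estimateLaw_sq hn]
    apply ENNReal.ofReal_le_ofReal
    rw [div_le_iff₀ hn', mul_assoc, ← hDd]
    exact h.pairSum_sq_le hlight hK'
  have hsqE : √(E : ℝ) ≤ E := Real.sqrt_le_iff.2 ⟨by linarith, by nlinarith⟩
  have hKd : K ≤ 12 * (k * d * E) := by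
    rw [hK, Real.sqrt_mul hD0.le]
    have := sqrt_numEntries_le hn hd hk
    gcongr
  have hcheb := prob_sumLaw_deviation_le (estimateLaw A ρ θ) (μ := F / n)
    (t := r * d / (2 * E)) (δ := 1 / 6) (by positivity) (by positivity)
    (h.expect_estimateLaw hn ρ θ) hM r (by
      calc (r : ℝ) * (4 * K * d) ≤ r * (4 * (12 * (k * d * E)) * d) := by gcongr
        _ = 1 / 6 * (r * d / (2 * E)) ^ 2 := by
          rw [hr_eq]
          field_simp
          ring)
  refine (prob_mono _ fun X hX => ?_).trans hcheb
  show r * d / (2 * E) ≤ |(X : ℝ) - r * (F / n)|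
  by_contra hlt
  rw [not_le, abs_lt] at hlt
  refine hX ⟨?_, ?_⟩
  · rw [lt_div_iff₀ hr0]
    have h1 : (r : ℝ) * (d * (1 - 1 / (3 * E))) ≤ r * (F / n) := by gcongr
    have h2 : (1 - 1 / (E : ℝ)) * d * r < r * (d * (1 - 1 / (3 * E))) - r * d / (2 * E) := by
      have h3 : r * (d * (1 - 1 / (3 * E))) - r * d / (2 * E) - (1 - 1 / (E : ℝ)) * d * r =
          r * d / (6 * E) := by
        field_simp
        ring
      have h4 : 0 < r * d / (6 * E) := by positivity
      linarith
    linarith [hlt.1]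
  · rw [div_lt_iff₀ hr0]
    have h1 : (r : ℝ) * (F / n) ≤ r * ((1 + 2 * min α (1 / 2)) * d) := by gcongr
    have h2 : r * ((1 + 2 * min α (1 / 2)) * d) + r * d / (2 * E) ≤
        (1 + 2 * min α (1 / 2) + 1 / (E : ℝ)) * d * r := by
      have h3 : (1 + 2 * min α (1 / 2) + 1 / (E : ℝ)) * d * r -
          (r * ((1 + 2 * min α (1 / 2)) * d) + r * d / (2 * E)) = r * d / (2 * E) := by
        field_simp
        ring
      have h4 : 0 < r * d / (2 * E) := by positivity
      linarith
    linarith [hlt.2]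

theorem Completes.prob_goodNumerators_ge (h : Completes A H L) {α : ℝ}
    (hα : (numErased A : ℝ) ≤ α * numEntries A) (hn : 0 < n) (hE : 0 < E)
    (hd : 1 ≤ avgDegree A) (hk : n ≤ k * k) :
    2 / 3 ≤ prob ((sumLaw ((unif n).map (degreeOf A)) (firstRounds k) 0).bind fun S =>
      sumLaw (estimateLaw A (firstRounds k) (S * n * E * 12)) (secondRounds k E) 0)
      (goodNumerators A k E α) := by
  set p := (sumLaw ((unif n).map (degreeOf A)) (firstRounds k) 0).bind fun S =>
      sumLaw (estimateLaw A (firstRounds k) (S * n * E * 12)) (secondRounds k E) 0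
  have h1 : prob p (goodNumerators A k E α)ᶜ ≤ ENNReal.ofReal (1 / 3) := by
    rw [show (1 / 3 : ℝ) = 1 / 6 + 1 / 6 by norm_num,
      ENNReal.ofReal_add (by norm_num) (by norm_num)]
    exact prob_bind_le _ _ _ _ (h.prob_not_goodSums_le hn hd hk) fun S hS =>
      h.prob_not_goodNumerators_le hα hn hE hd hk (not_not.1 hS)
  have h2 := prob_compl_add p (goodNumerators A k E α)
  have h3 : (2 / 3 : ℝ≥0∞) = ENNReal.ofReal (2 / 3) := by
    rw [ENNReal.ofReal_div_of_pos (by norm_num)]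
    simp
  have h4 : (1 : ℝ≥0∞) = ENNReal.ofReal (1 / 3) + ENNReal.ofReal (2 / 3) := by
    rw [← ENNReal.ofReal_add (by norm_num) (by norm_num)]
    norm_num
  rw [h3]
  refine (ENNReal.add_le_add_iff_left (a := ENNReal.ofReal (1 / 3)) ENNReal.ofReal_ne_top).1 ?_
  rw [← h4, ← h2]
  gcongr

end Analysis

/-! ### Query complexity -/

theorem exists_ceil_sqrt {n : ℕ} (hn : 0 < n) : ∃ k : ℕ, n ≤ k * k ∧ (∀ j < k, j * j < n) ∧
    k ≤ n ∧ (k : ℝ) ≤ 2 * √n := by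
  have h1 : (n - 1).sqrt * (n - 1).sqrt ≤ n - 1 := Nat.sqrt_le _
  have h2 := Nat.lt_succ_sqrt (n - 1)
  have h3 := Nat.sqrt_le_self (n - 1)
  rw [Nat.succ_eq_add_one] at h2
  refine ⟨(n - 1).sqrt + 1, by omega, fun j hj => ?_, by omega, ?_⟩
  · have := Nat.mul_self_le_mul_self (Nat.lt_succ_iff.1 hj)
    omega
  · have h4 : ((n - 1).sqrt : ℝ) ≤ √n := by
      apply Real.le_sqrt_of_sq_le
      rw [sq]
      exact_mod_cast h1.trans (Nat.sub_le n 1)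
    have h5 : (1 : ℝ) ≤ √n := by
      rw [Real.one_le_sqrt]
      exact_mod_cast hn
    push_cast
    linarith

end ErasureResilient

end

open ErasureResilient in
theorem theorem4 :
    ∃ (P : ErasureResilient.Program) (C : ℝ) (k : ℕ),
      ∀ (α ε : ℝ), α ∈ Set.Icc (0 : ℝ) 1 → ε ∈ Set.Ioo (0 : ℝ) (1 / 2) →
      ∀ (n : ℕ) (A : ErasureResilient.ErasedLists n),
        ErasureResilient.IsErasedGraph α A →
        1 ≤ ErasureResilient.avgDegree A →
        ∃ fuel : ℕ,
          -- every run halts, within the stated numbers of queries and steps, on short words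
          (∀ o ∈ (P.run A fuel (ErasureResilient.State.init n ⌈1 / ε⌉₊)).support,
            ∃ s : ErasureResilient.State, o = some s ∧
              (s.queries : ℝ) ≤
                C * (Real.sqrt n * max 1 (Real.log (Real.log n)) * (1 / ε) ^ k) ∧
              (s.steps : ℝ) ≤ C * (s.queries : ℝ) ∧
              (s.peak : ℝ) ≤ C * ((n : ℝ) / ε) ^ k) ∧
          -- the output is correct with probability at least 2/3
          (2 / 3 : ENNReal) ≤
            (P.run A fuel (ErasureResilient.State.init n ⌈1 / ε⌉₊)).toOuterMeasure
              {o | ∃ s : ErasureResilient.State, o = some s ∧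
                (1 - ε) * ErasureResilient.avgDegree A < s.output ∧
                s.output < (1 + 2 * min α (1 / 2) + ε) * ErasureResilient.avgDegree A} := by
  refine ⟨averageDegreeProgram, 100000, 3, ?_⟩
  rintro α ε - ⟨hε0, hε1⟩ n A ⟨⟨L, ⟨H, hH⟩, hL⟩, hα⟩ hd
  have h : Completes A H L := ⟨hH, hL⟩
  have hn : 0 < n := by
    rcases Nat.eq_zero_or_pos n with rfl | hn
    · -- the average degree of the empty graph is `0 / 0 = 0`
      norm_num [avgDegree] at hd
    · exact hn
  set E := ⌈1 / ε⌉₊ with hE_def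
  have hinv : 1 ≤ 1 / ε := by
    rw [le_div_iff₀ hε0]
    linarith
  have hE : 0 < E := Nat.ceil_pos.2 (by linarith)
  have hE1 : 1 / (E : ℝ) ≤ ε := by
    rw [one_div_le (by exact_mod_cast hE) hε0]
    exact Nat.le_ceil _
  have hE2 : (E : ℝ) ≤ 2 * (1 / ε) := by
    have := Nat.ceil_lt_add_one (show 0 ≤ 1 / ε by linarith)
    linarith
  have hE3 : (E : ℝ) ^ 3 ≤ 8 * (1 / ε) ^ 3 := by
    calc (E : ℝ) ^ 3 ≤ (2 * (1 / ε)) ^ 3 := by gcongr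
      _ = _ := by ring
  obtain ⟨k, hk, hk', hkn, hk2⟩ := exists_ceil_sqrt hn
  have hkpos : 0 < k := Nat.pos_of_ne_zero (by rintro rfl; omega)
  have hsim := averageDegreeProgram_simulates (A := A) (E := E)
    (fuel := k + firstRounds k + secondRounds k E + 1) hn hE hk hk' hkn h.length_le
    (by omega) (by omega) (by omega)
  refine ⟨k + firstRounds k + secondRounds k E + 1, fun o ho => ?_, ?_⟩
  · obtain ⟨X, s, rfl, hs⟩ := hsim.exists_of_mem_support ho
    refine ⟨s, rfl, ?_, ?_, ?_⟩
    · rw [hs.queries_eq, firstRounds, secondRounds]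
      push_cast
      have h1 : (1 : ℝ) ≤ (1 / ε) ^ 3 := one_le_pow₀ hinv
      calc 576 * (k : ℝ) + 3 * (1152 * k * E * E * E) = k * (576 + 3456 * (E : ℝ) ^ 3) := by ring
        _ ≤ 2 * √n * (576 * (1 / ε) ^ 3 + 3456 * (8 * (1 / ε) ^ 3)) := by
          gcongr
          linarith
        _ = 56448 * (√n * 1 * (1 / ε) ^ 3) := by ring
        _ ≤ 100000 * (√n * max 1 (Real.log (Real.log n)) * (1 / ε) ^ 3) := by
          gcongr
          · norm_num
          · exact le_max_left _ _
    · have h1 := hs.steps_le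
      have h2 := hs.queries_eq
      have h3 : s.steps ≤ 100000 * s.queries := by
        rw [firstRounds] at h1 h2
        omega
      exact_mod_cast h3
    · calc (s.peak : ℝ) ≤ wordBound n E := by exact_mod_cast hs.peak_le
        _ = 6912 * (n : ℝ) ^ 3 * (E : ℝ) ^ 3 := by
          rw [wordBound]
          push_cast
          rfl
        _ ≤ 6912 * (n : ℝ) ^ 3 * (8 * (1 / ε) ^ 3) := by gcongr
        _ = 55296 * ((n : ℝ) / ε) ^ 3 := by ring
        _ ≤ 100000 * ((n : ℝ) / ε) ^ 3 := by
          gcongr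
          norm_num
  · rw [← prob_eq_toOuterMeasure]
    refine (h.prob_goodNumerators_ge hα hn hE hd hk).trans ?_
    refine hsim.prob_le (good' := {s | (1 - ε) * avgDegree A < s.output ∧
      s.output < (1 + 2 * min α (1 / 2) + ε) * avgDegree A}) fun X s hs hX => ?_
    obtain ⟨h1, h2⟩ := hX
    have hout : s.output = (X : ℝ) / secondRounds k E := by rw [State.output, hs.cell0, hs.cell1]
    rw [Set.mem_ofPred_eq, hout]
    have h3 : 1 / (E : ℝ) * avgDegree A ≤ ε * avgDegree A := by gcongr
    constructor <;> linarith
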